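/- **Channel.** Let $K\ge 1$, $P>0$, $\sigma_F,\sigma_N\ge 0$. In channel use $t=0,1,2,\dots$ the transmitters $1,\dots,K$ send symbols $x_k(t)\in\mathbb C$ with $|x_k(t)|^2\le P$, and the receiver (the coordinator) observes $Y(t)=\sum_{k=1}^K H_k(t)x_k(t)+N(t)$. The real and imaginary parts of all $H_k(t)$ and all $N(t)$ are jointly independent with mean zero; the real and imaginary parts of $H_k(t)$ have variance $1$ and sub-gaussian norm at most $\sigma_F$, those of $N(t)$ have sub-gaussian norm at most $\sigma_N$, where $\tau(X)=\inf\{t>0:\ \mathbb E e^{\lambda(X-\mathbb EX)}\le e^{\lambda^2t^2/2}\ \forall\lambda\in\mathbb R\}$. Transmitter $k$ also has independent uniform random signs $U_k(t)\in\{-1,1\}$, independent of the channel. In addition the coordinator can multicast digital messages noiselessly to all agents. **Problem.** The agents $1,\dots,K$ hold pairwise distinct inputs $s_1,\dots,s_K$ from a totally ordered set $\mathcal S$, which is represented by infinite binary sequences through a strictly increasing map $\varphi:\mathcal S\to\{0,1\}^{\infty}$ (lexicographic order). The *maximum description length* $d$ is the maximum over $k$ of the least number of leading bits of $\varphi(s_k)$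 that distinguish it from all $\varphi(s_j)$, $j\ne k$. *Weak $m$-max-consensus* is reached if every agent has decided whether it belongs to the set of remaining agents, where this set is nonempty, has at most $m$ elements, and each of its members holds a larger input than every agent outside it (so it contains the agent with the maximal input). **Scheme (ScalableMax over the fading channel).** Fix integers $M,m>0$ with $m$ even. All parties keep a binary word $x$, initially empty. In each step the coordinator forms estimates $e_0,e_1,e_2$ of the numbers of agents $k$ for which, respectively, $\varphi(s_k)$ is lexicographically above all sequences with prefix $x$; $\varphi(s_k)$ has prefix $x$; $\varphi(s_k)$ has prefix $x1$. For each of the three estimates $M$ channel uses are made: an agent for which the condition holds transmits $\sqrt P\,U_k(t)$, the other agents transmit $0$, and the coordinator computes $\frac1{2MP}\sum_t\left(|Y(t)|^2-\mathbb E|N(t)|^2\right)$, the sum being over these $M$ uses. Then it makes one multicast: if $e_0\ge m/4$, the scheme ends and the agents above $x$ remain; otherwise, if $e_1<m/4+1$, the scheme ends and the agents above $x$ or with prefix $x$ remain; otherwise the bit $1$ (if $e_2\ge m/4$) or $0$ (if $e_2<m/4$) is appended to $x$ and the next step follows. **Claim.** With $\varepsilon=m/4$ and $L=3\sigma_F^2K+\frac{4\sigma_N\sigma_F\sqrt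 K}{\sqrt P}+\frac{2\sigma_N^2}{P}$, let $$\gamma=2\exp\left(-\frac{M\varepsilon^2}{4\sigma_F^2\varepsilon+32K\sigma_F^4}\right)+2\exp\left(-\frac{M\varepsilon^2}{4L\varepsilon+16L^2}\right)$$ and suppose that $\gamma\le 1$. Then the scheme respects the power constraint almost surely, and with probability at least $(1-\gamma)^{3(d+1)}$ it ends with weak $m$-max-consensus after at most $3M(d+1)$ uses of the channel and at most $M(d+1)$ digital multicasts. -/

import Mathlib

open MeasureTheory ProbabilityTheory
open scoped NNReal ENNReal

namespace MaxConsensus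

noncomputable section

/-! ### The fast-fading multiple-access channel -/

/-- The sub-gaussian norm `τ(X)`: the infimum of all `t > 0` such that
`𝔼 exp (lam * (X - 𝔼 X)) ≤ exp (lam ^ 2 * t ^ 2 / 2)` for every real `lam`
(it is `∞` if there is no such `t`). -/
def subGaussianNorm {Ω : Type*} [MeasurableSpace Ω] (X : Ω → ℝ) (μ : Measure Ω) : ℝ≥0∞ :=
  ⨅ t : {t : ℝ≥0 // 0 < t ∧ HasSubgaussianMGF (fun ω => X ω - ∫ ω', X ω' ∂μ) (t ^ 2) μ},
    ((t : ℝ≥0) : ℝ≥0∞)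

/-- The real random sources that act in one use of the channel with `K` transmitters: real and
imaginary part of each fading coefficient, real and imaginary part of the additive noise, and the
local random sign of each transmitter. -/
inductive Source (K : ℕ) : Type
  | fadingRe (k : Fin K)
  | fadingIm (k : Fin K)
  | noiseRe
  | noiseIm
  | sign (k : Fin K)

/-- The random variable that belongs to a source in the `t`-th channel use. -/
def sourceVar {Ω : Type*} {K : ℕ} (H : ℕ → Fin K → Ω → ℂ) (N : ℕ → Ω → ℂ)
    (U : ℕ → Fin K → Ω → ℝ) : ℕ × Source K → Ω → ℝ
  | (t, .fadingRe k), ω => (H t k ω).re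
  | (t, .fadingIm k), ω => (H t k ω).im
  | (t, .noiseRe), ω => (N t ω).re
  | (t, .noiseIm), ω => (N t ω).im
  | (t, .sign k), ω => U t k ω

/-- The probabilistic assumptions on the channel: `H t k` is the fading coefficient of transmitter
`k` and `N t` the additive noise in channel use `t`; `U t k` is the local randomness of
transmitter `k`, a uniformly distributed sign. -/
structure IsFadingChannel {Ω : Type*} [MeasurableSpace Ω] (μ : Measure Ω) {K : ℕ}
    (H : ℕ → Fin K → Ω → ℂ) (N : ℕ → Ω → ℂ) (U : ℕ → Fin K → Ω → ℝ) (σF σN : ℝ) : Prop where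
  measurable_fading : ∀ t k, Measurable (H t k)
  measurable_noise : ∀ t, Measurable (N t)
  measurable_sign : ∀ t k, Measurable (U t k)
  indep : iIndepFun (sourceVar H N U) μ
  fading_mean_re : ∀ t k, ∫ ω, (H t k ω).re ∂μ = 0
  fading_mean_im : ∀ t k, ∫ ω, (H t k ω).im ∂μ = 0
  fading_var_re : ∀ t k, variance (fun ω => (H t k ω).re) μ = 1
  fading_var_im : ∀ t k, variance (fun ω => (H t k ω).im) μ = 1
  fading_norm_re : ∀ t k, subGaussianNorm (fun ω => (H t k ω).re) μ ≤ ENNReal.ofReal σF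
  fading_norm_im : ∀ t k, subGaussianNorm (fun ω => (H t k ω).im) μ ≤ ENNReal.ofReal σF
  noise_mean_re : ∀ t, ∫ ω, (N t ω).re ∂μ = 0
  noise_mean_im : ∀ t, ∫ ω, (N t ω).im ∂μ = 0
  noise_norm_re : ∀ t, subGaussianNorm (fun ω => (N t ω).re) μ ≤ ENNReal.ofReal σN
  noise_norm_im : ∀ t, subGaussianNorm (fun ω => (N t ω).im) μ ≤ ENNReal.ofReal σN
  sign_pos : ∀ t k, μ {ω | U t k ω = 1} = 1 / 2
  sign_neg : ∀ t k, μ {ω | U t k ω = -1} = 1 / 2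

/-- `Y(t) = ∑ₖ Hₖ(t) xₖ(t) + N(t)`. -/
def channelOutput {Ω : Type*} {K : ℕ} (H : ℕ → Fin K → Ω → ℂ) (N : ℕ → Ω → ℂ) (t : ℕ)
    (x : Fin K → ℂ) (ω : Ω) : ℂ :=
  ∑ k, H t k ω * x k + N t ω

/-! ### Protocols in a star-shaped network -/

/-- A protocol for `K` agents with inputs in `α` and a coordinator. It proceeds in steps; a step
consists of `uses` uses of the multiple-access channel from the agents to the coordinator, followed
by one noiseless digital multicast from the coordinator to all agents. An agent knows its own input,
the multicasts so far, and its local randomness; the coordinator knows the channel outputs. -/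
structure StarProtocol (K : ℕ) (α Msg : Type*) where
  /-- number of channel uses in one step -/
  uses : ℕ
  /-- symbol sent by an agent: own input, multicasts so far, use within the step, local randomness -/
  symbol : Fin K → α → List Msg → Fin uses → ℝ → ℂ
  /-- the next multicast, from the multicasts so far and the channel outputs in this step -/
  multicast : List Msg → (Fin uses → ℂ) → Msg
  /-- whether the protocol has ended after these multicasts -/
  halted : List Msg → Bool
  /-- the final decision of an agent, from its own input and the multicasts -/
  decision : Fin K → α → List Msg → Bool

namespace StarProtocol

variable {K : ℕ} {α Msg Ω : Type*}

/-- The symbol transmitted by agent `k` in the `i`-th use of the step that follows the multicasts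
`h`; that step is step number `h.length`, so this is channel use `uses * h.length + i`. -/
def transmitted (p : StarProtocol K α Msg) (s : Fin K → α) (U : ℕ → Fin K → Ω → ℝ)
    (h : List Msg) (i : Fin p.uses) (k : Fin K) (ω : Ω) : ℂ :=
  p.symbol k (s k) h i (U (p.uses * h.length + i) k ω)

/-- The sequence of all multicasts in the first `t` steps (fewer if the protocol ends earlier). -/
def transcript (p : StarProtocol K α Msg) (s : Fin K → α) (H : ℕ → Fin K → Ω → ℂ)
    (N : ℕ → Ω → ℂ) (U : ℕ → Fin K → Ω → ℝ) (ω : Ω) : ℕ → List Msg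
  | 0 => []
  | t + 1 =>
    let h := transcript p s H N U ω t
    if p.halted h then h
    else h ++ [p.multicast h fun i =>
      channelOutput H N (p.uses * h.length + i) (fun k => p.transmitted s U h i k ω) ω]

/-- Peak power constraint: almost surely, no transmitted symbol has a power above `P`. -/
def PeakPowerConstraint [MeasurableSpace Ω] (p : StarProtocol K α Msg) (μ : Measure Ω)
    (s : Fin K → α) (H : ℕ → Fin K → Ω → ℂ) (N : ℕ → Ω → ℂ) (U : ℕ → Fin K → Ω → ℝ)
    (P : ℝ) : Prop :=
  ∀ᵐ ω ∂μ, ∀ (t : ℕ) (i : Fin p.uses) (k : Fin K),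
    ‖p.transmitted s U (p.transcript s H N U ω t) i k ω‖ ^ 2 ≤ P

end StarProtocol

/-- Weak `m`-max-consensus: every agent has decided whether it belongs to the set of remaining
agents; this set is nonempty, has at most `m` elements, and its members hold larger inputs than all
other agents (so every agent with the maximal input belongs to it). -/
def WeakMaxConsensus {K : ℕ} {α : Type*} [LinearOrder α] (m : ℕ) (s : Fin K → α)
    (out : Fin K → Bool) : Prop :=
  (∃ k, out k = true) ∧ {k | out k = true}.ncard ≤ m ∧
    ∀ i j, out i = true → out j = false → s j < s i

/-- The protocol ends with weak `m`-max-consensus after at most `a` channel uses and at most `b`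
multicasts. Each step contributes one multicast to the transcript. -/
def StarProtocol.Reaches {K : ℕ} {α Msg Ω : Type*} [LinearOrder α] (p : StarProtocol K α Msg)
    (m : ℕ) (s : Fin K → α) (H : ℕ → Fin K → Ω → ℂ) (N : ℕ → Ω → ℂ) (U : ℕ → Fin K → Ω → ℝ)
    (a b : ℕ) (ω : Ω) : Prop :=
  ∃ t : ℕ, p.halted (p.transcript s H N U ω t) = true ∧
    p.uses * (p.transcript s H N U ω t).length ≤ a ∧
    (p.transcript s H N U ω t).length ≤ b ∧
    WeakMaxConsensus m s fun k => p.decision k (s k) (p.transcript s H N U ω t)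

/-! ### Binary descriptions -/

/-- The first `n` bits of an infinite binary sequence. -/
def bitPrefix (b : Lex (ℕ → Bool)) (n : ℕ) : List Bool :=
  (List.range n).map (ofLex b)

/-- The number of leading bits needed to tell the sequence of agent `k` from those of all others. -/
def descriptionLength {K : ℕ} (b : Fin K → Lex (ℕ → Bool)) (k : Fin K) : ℕ :=
  sInf {n | ∀ j, j ≠ k → bitPrefix (b j) n ≠ bitPrefix (b k) n}

/-- The maximum description length `d` of the agents' sequences. -/
def maxDescriptionLength {K : ℕ} (b : Fin K → Lex (ℕ → Bool)) : ℕ :=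
  Finset.univ.sup (descriptionLength b)

/-- The sequence `b` starts with the word `x`. -/
def HasPrefix (x : List Bool) (b : Lex (ℕ → Bool)) : Prop :=
  bitPrefix b x.length = x

/-- The sequence `b` is lexicographically above all sequences that start with the word `x`. -/
def IsAbove (x : List Bool) (b : Lex (ℕ → Bool)) : Prop :=
  x < bitPrefix b x.length

/-! ### Approximation of a sum over the fading channel -/

/-- Pre-processing for the sum function on `[0,1]^K`: `√(P s) U`. -/
def sumEncode (P s u : ℝ) : ℂ :=
  ((Real.sqrt (P * s) * u : ℝ) : ℂ)

/-- Post-processing for the sum function: received energy minus expected noise energy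
`ν i = 𝔼 |N(i)|²`, normalized. -/
def sumDecode (P : ℝ) {M : ℕ} (ν : Fin M → ℝ) (y : Fin M → ℂ) : ℝ :=
  (∑ i, ‖y i‖ ^ 2 - ∑ i, ν i) / (2 * M * P)

/-- The bound `Γ₁ + Γ₂` on the probability that the sum function on `[0,1]^K` is approximated with
an error of at least `ε` after `M` channel uses. -/
def sumErrorBound (M K : ℕ) (σF σN P ε : ℝ) : ℝ :=
  let L : ℝ := 3 * σF ^ 2 * K + 4 * σN * σF * Real.sqrt K / Real.sqrt P + 2 * σN ^ 2 / P
  2 * Real.exp (-(M * ε ^ 2 / (4 * σF ^ 2 * ε + 32 * K * σF ^ 4))) +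
    2 * Real.exp (-(M * ε ^ 2 / (4 * L * ε + 16 * L ^ 2)))

/-! ### ScalableMax -/

/-- Digital messages of the coordinator: append a bit to the current word, or end the protocol. In
the latter case the flag says whether the agents whose sequences start with the current word remain,
in addition to the agents above it. -/
inductive Message : Type
  | append (b : Bool)
  | finish (withPrefix : Bool)

/-- The current word: all bits appended so far. -/
def currentWord (h : List Message) : List Bool :=
  h.filterMap fun
    | .append b => some b
    | .finish _ => none

/-- The three questions of a step: the agents above the current word `x`, the agents whose
sequences start with `x`, and the agents whose sequences start with `x` followed by the bit `1`. -/
def Query (x : List Bool) (b : Lex (ℕ → Bool)) (q : Fin 3) : Prop :=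
  ![IsAbove x b, HasPrefix x b, HasPrefix (x ++ [true]) b] q

/-- The coordinator's reaction to the estimates `e 0, e 1, e 2` of the numbers of agents which
answer the three questions in the affirmative. -/
def react (m : ℕ) (e : Fin 3 → ℝ) : Message :=
  if (m : ℝ) / 4 ≤ e 0 then .finish false
  else if e 1 < (m : ℝ) / 4 + 1 then .finish true
  else if (m : ℝ) / 4 ≤ e 2 then .append true
  else .append false

open Classical in
/-- ScalableMax with each idealized channel use replaced by `M` uses of the fading channel. The
agents' inputs are represented by binary sequences through `φ`, and `ν t` is the noise energy that
the coordinator expects in channel use `t`. Use number `i + M * q` of a step serves question `q`. -/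
def scalableMax (K M m : ℕ) {α : Type*} (φ : α → Lex (ℕ → Bool)) (P : ℝ) (ν : ℕ → ℝ) :
    StarProtocol K α Message where
  uses := 3 * M
  symbol _ a h i u :=
    sumEncode P (if Query (currentWord h) (φ a) (finProdFinEquiv.symm i).1 then 1 else 0) u
  multicast h y := react m fun q =>
    sumDecode P (fun i : Fin M => ν (3 * M * h.length + (finProdFinEquiv (q, i) : Fin (3 * M))))
      (fun i : Fin M => y (finProdFinEquiv (q, i)))
  halted h := match h.getLast? with
    | some (.finish _) => true
    | _ => false
  decision _ a h := match h.getLast? with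
    | some (.finish withPrefix) =>
      decide (IsAbove (currentWord h) (φ a) ∨
        (withPrefix = true ∧ HasPrefix (currentWord h) (φ a)))
    | _ => false

end

end MaxConsensus

open MaxConsensus

namespace MaxConsensus

/-! ### Squares of sub-gaussian random variables -/

/-! The argument has a deterministic half and a probabilistic half. Deterministically, suppose that
every estimate has an error below `m/4`. Then the current word keeps the invariant `Admissible`:
some agent is above it or has it as a prefix, and at most `m` agents are above it. An ending step
leaves an admissible set of remaining agents (`react_eq_finish`). An appending step preserves the
invariant and certifies that two agents share the current word (`react_eq_append`), so the word is
shorter than `d`. Hence the scheme ends within `d + 1` steps. The remaining agents are closed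
upwards in the input order, which yields the consensus.

For one estimate, the real and the imaginary part of the output are signed sums of independent
terms, hence sub-gaussian, and their second moments carry the number of active agents. Squares of
sub-gaussian variables have a Gaussian-type moment generating function near the origin
(`mgf_sq_sub_integral_le`), and a Chernoff bound over the `M` uses gives the error probability
(`IsFadingChannel.measureReal_sumDecode_error_le`).

The word in question is random, but it is determined by earlier channel uses, while the estimates of
a step use fresh ones. Conditioning on the transcript (`mul_measure_le_measure_adaptive`) therefore
multiplies the success probabilities: three factors `1 - γ` for each of `d + 1` steps. -/

theorem exp_mul_le_one_add_sq_mul {θ : ℝ} (hθ : |θ| ≤ 1) (z : ℝ) :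
    Real.exp (θ * z) ≤ 1 + θ * z + θ ^ 2 * (Real.exp |z| - 1) := by
  have h1 : HasSum (fun n : ℕ => (θ * z) ^ n / n.factorial) (Real.exp (θ * z)) := by
    rw [Real.exp_eq_exp_ℝ]; exact NormedSpace.expSeries_div_hasSum_exp _
  have h2 : HasSum (fun n : ℕ => |z| ^ n / n.factorial) (Real.exp |z|) := by
    rw [Real.exp_eq_exp_ℝ]; exact NormedSpace.expSeries_div_hasSum_exp _
  -- From degree 2 on, `|θ| ≤ 1` lets `θ ^ 2` be pulled out of every term; the linear term of `exp
  -- |z|` is discarded at the end.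
  rw [← hasSum_nat_add_iff' 2] at h1 h2
  have h3 := h2.mul_left (θ ^ 2)
  have h4 := hasSum_le (fun n => ?_) h1 h3
  · simp [Finset.sum_range_succ] at h4
    nlinarith [mul_nonneg (sq_nonneg θ) (abs_nonneg z)]
  · rw [← mul_div_assoc]
    gcongr
    calc (θ * z) ^ (n + 2) ≤ |(θ * z) ^ (n + 2)| := le_abs_self _
      _ = |θ| ^ n * (θ ^ 2 * |z| ^ (n + 2)) := by
        rw [abs_pow, abs_mul, mul_pow, pow_add |θ|, sq_abs, mul_assoc]
      _ ≤ 1 * (θ ^ 2 * |z| ^ (n + 2)) := by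
        gcongr
        exact pow_le_one₀ (abs_nonneg _) hθ
      _ = _ := one_mul _

theorem integral_exp_sq_div_four_gaussianReal :
    ∫⁻ g, ENNReal.ofReal (Real.exp (g ^ 2 / 4)) ∂(gaussianReal 0 1) = ENNReal.ofReal √2 := by
  have hpi := Real.pi_pos
  have key : ∀ g : ℝ, gaussianPDFReal 0 1 g * Real.exp (g ^ 2 / 4) =
      (√(2 * Real.pi))⁻¹ * Real.exp (-(1 / 4) * g ^ 2) := by
    intro g
    simp only [gaussianPDFReal, NNReal.coe_one, mul_one, sub_zero]
    rw [mul_assoc, ← Real.exp_add]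
    ring_nf
  have hint : Integrable (fun g : ℝ => Real.exp (-(1 / 4) * g ^ 2)) :=
    integrable_exp_neg_mul_sq (by norm_num)
  rw [gaussianReal_of_var_ne_zero _ one_ne_zero,
    lintegral_withDensity_eq_lintegral_mul _ (measurable_gaussianPDF 0 1) (by fun_prop)]
  have : ∀ g : ℝ, (gaussianPDF 0 1 * fun g => ENNReal.ofReal (Real.exp (g ^ 2 / 4))) g =
      ENNReal.ofReal ((√(2 * Real.pi))⁻¹ * Real.exp (-(1 / 4) * g ^ 2)) := by
    intro g
    rw [← key, ENNReal.ofReal_mul (gaussianPDFReal_nonneg _ _ _)]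
    rfl
  simp_rw [this]
  rw [← ofReal_integral_eq_lintegral_ofReal (hint.const_mul _)
    (ae_of_all _ fun g => by positivity), integral_const_mul, integral_gaussian]
  congr 1
  rw [← Real.sqrt_inv, ← Real.sqrt_mul (by positivity)]
  congr 1
  field_simp
  norm_num

section SubGaussian

variable {Ω : Type*} [MeasurableSpace Ω] {μ : Measure Ω}

/-- Linearize the square with an auxiliary standard Gaussian `g`: `exp (x ^ 2 / (4 * v))` is the
mean of `exp (r * x * g)` for `r ^ 2 = 1 / (2 * v)`. After swapping the integrals, the sub-gaussian
bound in `X` leaves the mean of `exp (g ^ 2 / 4)`, which is `√2`. Lower integrals make the swap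
possible before integrability is known. -/
theorem lintegral_exp_sq_le [IsFiniteMeasure μ] {X : Ω → ℝ} {v : ℝ≥0} (hX : Measurable X)
    (hv : 0 < v) (h : HasSubgaussianMGF X v μ) :
    ∫⁻ ω, ENNReal.ofReal (Real.exp (X ω ^ 2 / (4 * v))) ∂μ ≤ ENNReal.ofReal √2 := by
  have hv' : (0 : ℝ) < v := hv
  set r : ℝ := √(1 / (2 * v)) with hr
  have hr2 : r ^ 2 = 1 / (2 * v) := Real.sq_sqrt (by positivity)
  have inner : ∀ x : ℝ, ENNReal.ofReal (Real.exp (x ^ 2 / (4 * v))) =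
      ∫⁻ g, ENNReal.ofReal (Real.exp ((r * x) * g)) ∂(gaussianReal 0 1) := by
    intro x
    rw [← ofReal_integral_eq_lintegral_ofReal (integrable_exp_mul_gaussianReal _)
      (ae_of_all _ fun g => by positivity)]
    have := congrFun (mgf_fun_id_gaussianReal (μ := 0) (v := 1)) (r * x)
    simp only [mgf] at this
    rw [this, mul_pow, hr2]
    congr 2
    push_cast
    field_simp
    ring
  simp_rw [inner]
  rw [lintegral_lintegral_swap (by fun_prop), ← integral_exp_sq_div_four_gaussianReal]
  refine lintegral_mono fun g => ?_
  have e : ∀ ω, r * X ω * g = (r * g) * X ω := fun ω => by ring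
  simp_rw [e]
  rw [← ofReal_integral_eq_lintegral_ofReal (h.integrable_exp_mul _)
      (ae_of_all _ fun g => by positivity)]
  refine ENNReal.ofReal_le_ofReal ((h.mgf_le (r * g)).trans_eq ?_)
  rw [mul_pow, hr2]
  congr 1
  field_simp
  ring

theorem integrable_exp_sq [IsFiniteMeasure μ] {X : Ω → ℝ} {v : ℝ≥0} (hX : Measurable X)
    (hv : 0 < v) (h : HasSubgaussianMGF X v μ) :
    Integrable (fun ω => Real.exp (X ω ^ 2 / (4 * v))) μ := by
  refine ⟨by fun_prop, ?_⟩
  rw [hasFiniteIntegral_iff_ofReal (ae_of_all _ fun ω => by positivity)]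
  exact (lintegral_exp_sq_le hX hv h).trans_lt ENNReal.ofReal_lt_top

theorem integral_exp_sq_le [IsFiniteMeasure μ] {X : Ω → ℝ} {v : ℝ≥0} (hX : Measurable X)
    (hv : 0 < v) (h : HasSubgaussianMGF X v μ) :
    ∫ ω, Real.exp (X ω ^ 2 / (4 * v)) ∂μ ≤ √2 := by
  rw [integral_eq_lintegral_of_nonneg_ae (ae_of_all _ fun ω => by positivity) (by fun_prop)]
  exact ENNReal.toReal_le_of_le_ofReal (by positivity) (lintegral_exp_sq_le hX hv h)

theorem integrable_sq_of_hasSubgaussianMGF {X : Ω → ℝ} {v : ℝ≥0}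
    (h : HasSubgaussianMGF X v μ) : Integrable (fun ω => X ω ^ 2) μ := by
  have := h.memLp 2
  exact this.integrable_sq

/-- The centred square of a sub-gaussian random variable has a moment generating function of
gaussian type near the origin. -/
theorem mgf_sq_sub_integral_le [IsProbabilityMeasure μ] {X : Ω → ℝ} {v : ℝ≥0} (hX : Measurable X)
    (hv : 0 < v) (h : HasSubgaussianMGF X v μ) {r : ℝ} (hr : |r| ≤ 1 / (4 * v)) :
    Integrable (fun ω => Real.exp (r * (X ω ^ 2 - ∫ ω', X ω' ^ 2 ∂μ))) μ ∧
      ∫ ω, Real.exp (r * (X ω ^ 2 - ∫ ω', X ω' ^ 2 ∂μ)) ∂μ ≤ Real.exp (16 * v ^ 2 * r ^ 2) := by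
  have hv' : (0 : ℝ) < v := hv
  set a : ℝ := ∫ ω', X ω' ^ 2 ∂μ with ha
  have ha0 : 0 ≤ a := integral_nonneg fun ω => sq_nonneg _
  have hsq := integrable_sq_of_hasSubgaussianMGF h
  have hexp := integrable_exp_sq hX hv h
  have hle := integral_exp_sq_le hX hv h
  have hs2 : √2 ≤ 1.415 := by
    rw [Real.sqrt_le_left (by norm_num)]; norm_num
  -- Integrating `1 + y ≤ exp y` at `y = X ^ 2 / (4 * v)` gives `a / (4 * v) ≤ √2 - 1`.
  have ha1 : a / (4 * v) ≤ 0.415 := by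
    have : ∫ ω, (X ω ^ 2 / (4 * v) + 1) ∂μ ≤ ∫ ω, Real.exp (X ω ^ 2 / (4 * v)) ∂μ :=
      integral_mono ((hsq.div_const _).add (integrable_const 1)) hexp
        fun ω => Real.add_one_le_exp _
    rw [integral_add (hsq.div_const _) (integrable_const 1), integral_div] at this
    simp at this
    linarith
  have hea : Real.exp (a / (4 * v)) ≤ 1.55 := by
    refine (Real.exp_le_exp.2 ha1).trans ?_
    have := Real.exp_bound' (x := 0.415) (by norm_num) (by norm_num) (n := 4) (by norm_num)
    refine this.trans ?_
    norm_num [Finset.sum_range_succ, Nat.factorial]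
  -- In units of `4 * v` the range of `r` becomes `|θ| ≤ 1`, and the target exponent becomes `θ ^
  -- 2`.
  set θ : ℝ := r * (4 * v) with hθ
  have hθ1 : |θ| ≤ 1 := by
    rw [hθ, abs_mul, abs_of_pos (show (0 : ℝ) < 4 * v by positivity)]
    calc |r| * (4 * v) ≤ 1 / (4 * v) * (4 * v) := by gcongr
      _ = 1 := by field_simp
  have hpt : ∀ ω, Real.exp (r * (X ω ^ 2 - a)) ≤
      1 + r * (X ω ^ 2 - a) + θ ^ 2 * (Real.exp (X ω ^ 2 / (4 * v)) + 0.55 - 1) := by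
    intro ω
    have e : r * (X ω ^ 2 - a) = θ * ((X ω ^ 2 - a) / (4 * v)) := by
      rw [hθ]; field_simp
    rw [e]
    refine (exp_mul_le_one_add_sq_mul hθ1 _).trans ?_
    gcongr
    have h1 : 1 ≤ Real.exp (X ω ^ 2 / (4 * v)) := Real.one_le_exp (by positivity)
    rw [abs_div, abs_of_pos (show (0 : ℝ) < 4 * v by positivity)]
    -- Above its mean the deviation is dominated by `X ^ 2` itself; below it, by `a`, where `exp (a
    -- / (4 * v)) ≤ 1.55 ≤ exp (X ^ 2 / (4 * v)) + 0.55`.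
    rcases le_total a (X ω ^ 2) with h2 | h2
    · rw [abs_of_nonneg (sub_nonneg.2 h2)]
      have : Real.exp ((X ω ^ 2 - a) / (4 * v)) ≤ Real.exp (X ω ^ 2 / (4 * v)) := by
        gcongr; linarith
      linarith
    · rw [abs_of_nonpos (sub_nonpos.2 h2)]
      have : Real.exp (-(X ω ^ 2 - a) / (4 * v)) ≤ Real.exp (a / (4 * v)) := by
        gcongr; nlinarith [sq_nonneg (X ω)]
      linarith
  have i1 : Integrable (fun ω => r * (X ω ^ 2 - a)) μ :=
    (hsq.sub (integrable_const a)).const_mul r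
  have i2 : Integrable (fun ω => θ ^ 2 * (Real.exp (X ω ^ 2 / (4 * v)) + 0.55 - 1)) μ :=
    ((hexp.add (integrable_const _)).sub (integrable_const _)).const_mul _
  have i3 : Integrable (fun ω => 1 + r * (X ω ^ 2 - a) +
      θ ^ 2 * (Real.exp (X ω ^ 2 / (4 * v)) + 0.55 - 1)) μ :=
    ((integrable_const 1).add i1).add i2
  have i0 : Integrable (fun ω => Real.exp (r * (X ω ^ 2 - a))) μ := by
    refine i3.mono' (by fun_prop) (ae_of_all _ fun ω => ?_)
    rw [Real.norm_of_nonneg (by positivity)]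
    exact hpt ω
  refine ⟨i0, (integral_mono i0 i3 hpt).trans ?_⟩
  have e1 : ∫ ω, (1 + r * (X ω ^ 2 - a) +
      θ ^ 2 * (Real.exp (X ω ^ 2 / (4 * v)) + 0.55 - 1)) ∂μ =
      1 + θ ^ 2 * (∫ ω, Real.exp (X ω ^ 2 / (4 * v)) ∂μ + 0.55 - 1) := by
    have i4 : Integrable (fun ω => 1 + r * (X ω ^ 2 - a)) μ := (integrable_const 1).add i1
    have i5 : Integrable (fun ω => Real.exp (X ω ^ 2 / (4 * v)) + 0.55) μ :=
      hexp.add (integrable_const _)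
    rw [integral_add i4 i2, integral_add (integrable_const 1) i1,
      integral_const_mul, integral_const_mul, integral_sub hsq (integrable_const a),
      integral_sub i5 (integrable_const _),
      integral_add hexp (integrable_const _)]
    simp [← ha]
  rw [e1]
  have e2 : 16 * (v : ℝ) ^ 2 * r ^ 2 = θ ^ 2 := by rw [hθ]; ring
  rw [e2]
  refine le_trans ?_ (Real.add_one_le_exp _)
  -- The numerical constants were chosen so that `√2 + 0.55 - 1 < 1`.
  nlinarith [sq_nonneg θ]

/-! ### The sub-gaussian norm -/

/-- The infimum need not be attained a priori: the bound holds for every `r > σ` and passes to the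
limit `r ↓ σ` by continuity. This covers `σ = 0` too. -/
theorem hasSubgaussianMGF_of_subGaussianNorm_le {X : Ω → ℝ} {σ : ℝ} (hσ : 0 ≤ σ)
    (h0 : ∫ ω, X ω ∂μ = 0) (h : subGaussianNorm X μ ≤ ENNReal.ofReal σ) :
    HasSubgaussianMGF X (σ.toNNReal ^ 2) μ := by
  have key : ∀ r : ℝ≥0, σ.toNNReal < r → ∃ t : ℝ≥0, t < r ∧ HasSubgaussianMGF X (t ^ 2) μ := by
    intro r hr
    have : subGaussianNorm X μ < r := h.trans_lt (ENNReal.coe_lt_coe.2 hr)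
    obtain ⟨⟨t, ht0, ht⟩, htr⟩ := iInf_lt_iff.1 this
    simp only [h0, sub_zero] at ht
    exact ⟨t, by exact_mod_cast htr, ht⟩
  constructor
  · obtain ⟨t, -, ht⟩ := key (σ.toNNReal + 1) (by simp)
    exact ht.integrable_exp_mul
  · intro l
    have hc : Filter.Tendsto (fun r : ℝ => Real.exp (r ^ 2 * l ^ 2 / 2)) (nhdsWithin σ (Set.Ioi σ))
        (nhds (Real.exp (σ ^ 2 * l ^ 2 / 2))) :=
      (Continuous.tendsto (by fun_prop) σ).mono_left nhdsWithin_le_nhds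
    have : mgf X μ l ≤ Real.exp (σ ^ 2 * l ^ 2 / 2) := by
      refine ge_of_tendsto hc ?_
      filter_upwards [self_mem_nhdsWithin] with r hr
      have hr : σ < r := hr
      have hr0 : 0 < r := hσ.trans_lt hr
      obtain ⟨t, htr, ht⟩ := key r.toNNReal ((Real.toNNReal_lt_toNNReal_iff hr0).2 hr)
      refine (ht.mgf_le l).trans ?_
      have : (t : ℝ) ≤ r := by
        have := NNReal.coe_le_coe.2 htr.le
        rwa [Real.coe_toNNReal _ hr0.le] at this
      push_cast
      gcongr
    simpa [Real.coe_toNNReal _ hσ] using this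

theorem hasSubgaussianMGF_mono {X : Ω → ℝ} {c c' : ℝ≥0} (h : HasSubgaussianMGF X c μ)
    (hc : c ≤ c') : HasSubgaussianMGF X c' μ := by
  refine ⟨h.integrable_exp_mul, fun t => (h.mgf_le t).trans ?_⟩
  have : (c : ℝ) ≤ c' := hc
  gcongr

/-! ### Independence of groups of random variables -/

theorem iIndep_iSup_of_pairwise_disjoint {ι κ : Type*} {m : ι → MeasurableSpace Ω}
    (hle : ∀ i, m i ≤ ‹MeasurableSpace Ω›) (h : iIndep m μ) {S : κ → Set ι}
    (hS : Pairwise fun a b => Disjoint (S a) (S b)) :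
    iIndep (fun k => ⨆ i ∈ S k, m i) μ := by
  classical
  have := h.isProbabilityMeasure
  rw [iIndep_iff]
  intro s f hf
  induction s using Finset.induction_on with
  | empty => simp
  | insert a s ha ih =>
    rw [Finset.set_biInter_insert, Finset.prod_insert ha,
      ← ih fun i hi => hf i (Finset.mem_insert_of_mem hi)]
    have hd : Disjoint (S a) (⋃ k ∈ s, S k) := by
      simp only [Set.disjoint_iUnion_right]
      intro k hk
      exact hS fun e => ha (e ▸ hk)
    refine (Indep_iff _ _ μ).1 (indep_iSup_of_disjoint hle h hd) _ _
      (hf a (Finset.mem_insert_self _ _)) ?_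
    refine MeasurableSet.biInter s.countable_toSet fun k hk => ?_
    have hk' : (⨆ i ∈ S k, m i) ≤ ⨆ i ∈ ⋃ k ∈ s, S k, m i :=
      biSup_mono fun i hi => Set.mem_biUnion hk hi
    exact hk' _ (hf k (Finset.mem_insert_of_mem hk))

end SubGaussian

/-! ### Sums of randomly signed sub-gaussian random variables -/

section SignedSum

/-- The independent summands of a noisy signed sum: the noise and the signed, weighted terms. -/
def signedTerm {Ω : Type*} {K : ℕ} (F V : Fin K → Ω → ℝ) (Z : Ω → ℝ) (a : Fin K → ℝ) :
    Option (Fin K) → Ω → ℝ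
  | none => Z
  | some k => fun ω => a k * (F k ω * V k ω)

theorem sum_signedTerm {Ω : Type*} {K : ℕ} (F V : Fin K → Ω → ℝ) (Z : Ω → ℝ) (a : Fin K → ℝ)
    (ω : Ω) :
    ∑ o, signedTerm F V Z a o ω = ∑ k, a k * (F k ω * V k ω) + Z ω := by
  rw [Fintype.sum_option, add_comm]
  rfl

variable {Ω : Type*} [MeasurableSpace Ω] {μ : Measure Ω}

/-- Splitting by the value of `V`, independence makes the moment generating function of `F * V` at
`t` a convex combination of those of `F` at `t` and `-t`, which obey the same bound. -/
theorem hasSubgaussianMGF_mul_sign [IsProbabilityMeasure μ] {F V : Ω → ℝ} {c : ℝ≥0}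
    (hV : Measurable V) (hind : IndepFun F V μ) (hF : HasSubgaussianMGF F c μ)
    (hV1 : ∀ᵐ ω ∂μ, V ω = 1 ∨ V ω = -1) :
    HasSubgaussianMGF (fun ω => F ω * V ω) c μ := by
  have hbound : ∀ᵐ ω ∂μ, ‖V ω‖ ≤ 1 := by
    filter_upwards [hV1] with ω h
    rcases h with h | h <;> simp [h]
  have hVint : Integrable V μ := Integrable.of_bound hV.aestronglyMeasurable 1 hbound
  have hexp : ∀ t : ℝ, (fun ω => Real.exp (t * (F ω * V ω))) =ᵐ[μ] fun ω =>
      Real.exp (t * F ω) * ((1 + V ω) / 2) + Real.exp (-t * F ω) * ((1 - V ω) / 2) := by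
    intro t
    filter_upwards [hV1] with ω h
    rcases h with h | h <;> simp [h]
  have hp : Integrable (fun ω => (1 + V ω) / 2) μ := ((integrable_const 1).add hVint).div_const 2
  have hq : Integrable (fun ω => (1 - V ω) / 2) μ := ((integrable_const 1).sub hVint).div_const 2
  have hi : ∀ (g : ℝ → ℝ), Measurable g → ∀ t,
      IndepFun (fun ω => Real.exp (t * F ω)) (fun ω => g (V ω)) μ := fun g hg t =>
    hind.comp (φ := fun x => Real.exp (t * x)) (ψ := g) (by fun_prop) hg
  have hi1 : ∀ t, IndepFun (fun ω => Real.exp (t * F ω)) (fun ω => (1 + V ω) / 2) μ :=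
    hi (fun x => (1 + x) / 2) (by fun_prop)
  have hi2 : ∀ t, IndepFun (fun ω => Real.exp (t * F ω)) (fun ω => (1 - V ω) / 2) μ :=
    hi (fun x => (1 - x) / 2) (by fun_prop)
  have I1 : ∀ t, Integrable (fun ω => Real.exp (t * F ω) * ((1 + V ω) / 2)) μ := fun t =>
    (hi1 t).integrable_mul (hF.integrable_exp_mul t) hp
  have I2 : ∀ t, Integrable (fun ω => Real.exp (t * F ω) * ((1 - V ω) / 2)) μ := fun t =>
    (hi2 t).integrable_mul (hF.integrable_exp_mul t) hq
  refine ⟨fun t => ((I1 t).add (I2 (-t))).congr (hexp t).symm, fun t => ?_⟩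
  have hp0 : 0 ≤ ∫ ω, (1 + V ω) / 2 ∂μ := by
    refine integral_nonneg_of_ae ?_
    filter_upwards [hV1] with ω h
    rcases h with h | h <;> simp [h]
  have hq0 : 0 ≤ ∫ ω, (1 - V ω) / 2 ∂μ := by
    refine integral_nonneg_of_ae ?_
    filter_upwards [hV1] with ω h
    rcases h with h | h <;> simp [h]
  have hpq : ∫ ω, (1 + V ω) / 2 ∂μ + ∫ ω, (1 - V ω) / 2 ∂μ = 1 := by
    rw [← integral_add hp hq]
    have : ∀ ω, (1 + V ω) / 2 + (1 - V ω) / 2 = 1 := fun ω => by ring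
    simp [this]
  have e1 := (hi1 t).integral_fun_mul_eq_mul_integral
    (hF.integrable_exp_mul t).aestronglyMeasurable hp.aestronglyMeasurable
  have e2 := (hi2 (-t)).integral_fun_mul_eq_mul_integral
    (hF.integrable_exp_mul (-t)).aestronglyMeasurable hq.aestronglyMeasurable
  have m1 := hF.mgf_le t
  have m2 := hF.mgf_le (-t)
  rw [neg_sq] at m2
  unfold mgf at m1 m2 ⊢
  rw [integral_congr_ae (hexp t), integral_add (I1 t) (I2 (-t)), e1, e2]
  calc _ ≤ Real.exp (c * t ^ 2 / 2) * ∫ ω, (1 + V ω) / 2 ∂μ +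
        Real.exp (c * t ^ 2 / 2) * ∫ ω, (1 - V ω) / 2 ∂μ := by gcongr
    _ = _ := by rw [← mul_add, hpq, mul_one]

variable {K : ℕ} {F V : Fin K → Ω → ℝ} {Z : Ω → ℝ} {σ ζ : ℝ≥0}

theorem iIndepFun_signedTerm
    (hind : iIndepFun (Sum.elim (Sum.elim F V) fun _ : Unit => Z) μ)
    (hF : ∀ k, Measurable (F k)) (hV : ∀ k, Measurable (V k)) (hZ : Measurable Z)
    (a : Fin K → ℝ) : iIndepFun (signedTerm F V Z a) μ := by
  let S : Option (Fin K) → Set ((Fin K ⊕ Fin K) ⊕ Unit) := fun o =>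
    o.elim {Sum.inr ()} fun k => {Sum.inl (Sum.inl k), Sum.inl (Sum.inr k)}
  have hS : Pairwise fun a b => Disjoint (S a) (S b) := by
    intro o o' h
    cases o <;> cases o' <;> simp_all [S, eq_comm]
  have hm : ∀ i, Measurable ((Sum.elim (Sum.elim F V) fun _ : Unit => Z) i) := by
    rintro ((k | k) | k)
    exacts [hF k, hV k, hZ]
  have := iIndep_iSup_of_pairwise_disjoint (fun i => (hm i).comap_le) hind.iIndep hS
  refine iIndep_of_iIndep_of_le this ?_
  have hle : ∀ o, ∀ i ∈ S o, MeasurableSpace.comap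
      ((Sum.elim (Sum.elim F V) fun _ : Unit => Z) i) inferInstance ≤
      ⨆ i ∈ S o, MeasurableSpace.comap
        ((Sum.elim (Sum.elim F V) fun _ : Unit => Z) i) inferInstance := fun o i hi =>
    le_biSup (fun i => MeasurableSpace.comap
        ((Sum.elim (Sum.elim F V) fun _ : Unit => Z) i) inferInstance) hi
  rintro (_ | k)
  · exact hle none (Sum.inr ()) rfl
  · refine Measurable.comap_le ?_
    have h1 := (comap_measurable (F k)).mono
      (hle (some k) (Sum.inl (Sum.inl k)) (by simp [S])) le_rfl
    have h2 := (comap_measurable (V k)).mono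
      (hle (some k) (Sum.inl (Sum.inr k)) (by simp [S])) le_rfl
    exact (h1.mul h2).const_mul (a k)

theorem indepFun_sign
    (hind : iIndepFun (Sum.elim (Sum.elim F V) fun _ : Unit => Z) μ)
    (k : Fin K) : IndepFun (F k) (V k) μ :=
  hind.indepFun (i := Sum.inl (Sum.inl k)) (j := Sum.inl (Sum.inr k)) (by simp)

theorem hasSubgaussianMGF_signedTerm
    (hind : iIndepFun (Sum.elim (Sum.elim F V) fun _ : Unit => Z) μ) (hV : ∀ k, Measurable (V k))
    (hFs : ∀ k, HasSubgaussianMGF (F k) σ μ) (hZs : HasSubgaussianMGF Z ζ μ)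
    (hV1 : ∀ k, ∀ᵐ ω ∂μ, V k ω = 1 ∨ V k ω = -1)
    (a : Fin K → ℝ) (o : Option (Fin K)) :
    HasSubgaussianMGF (signedTerm F V Z a o)
      (o.elim ζ fun k => (a k ^ 2).toNNReal * σ) μ := by
  have := hind.isProbabilityMeasure
  rcases o with _ | k
  · exact hZs
  · rw [Option.elim_some, Real.toNNReal_of_nonneg (sq_nonneg (a k))]
    exact (hasSubgaussianMGF_mul_sign (hV k) (indepFun_sign hind k) (hFs k) (hV1 k)).const_mul (a k)

theorem hasSubgaussianMGF_signedSum
    (hind : iIndepFun (Sum.elim (Sum.elim F V) fun _ : Unit => Z) μ) (hF : ∀ k, Measurable (F k))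
    (hV : ∀ k, Measurable (V k)) (hZ : Measurable Z) (hFs : ∀ k, HasSubgaussianMGF (F k) σ μ)
    (hZs : HasSubgaussianMGF Z ζ μ) (hV1 : ∀ k, ∀ᵐ ω ∂μ, V k ω = 1 ∨ V k ω = -1)
    (a : Fin K → ℝ) :
    HasSubgaussianMGF (fun ω => ∑ k, a k * (F k ω * V k ω) + Z ω)
      (∑ k, (a k ^ 2).toNNReal * σ + ζ) μ := by
  have h := HasSubgaussianMGF.sum_of_iIndepFun (s := Finset.univ)
    (iIndepFun_signedTerm hind hF hV hZ a)
    fun o _ => hasSubgaussianMGF_signedTerm hind hV hFs hZs hV1 a o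
  simp only [sum_signedTerm] at h
  rwa [Fintype.sum_option, add_comm] at h

/-- The summands are centred and pairwise independent, so variances add; the signs disappear because
`V ^ 2 = 1`. -/
theorem integral_sq_signedSum
    (hind : iIndepFun (Sum.elim (Sum.elim F V) fun _ : Unit => Z) μ) (hF : ∀ k, Measurable (F k))
    (hV : ∀ k, Measurable (V k)) (hZ : Measurable Z) (hFs : ∀ k, HasSubgaussianMGF (F k) σ μ)
    (hZs : HasSubgaussianMGF Z ζ μ) (hV1 : ∀ k, ∀ᵐ ω ∂μ, V k ω = 1 ∨ V k ω = -1)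
    (hF0 : ∀ k, ∫ ω, F k ω ∂μ = 0) (hZ0 : ∫ ω, Z ω ∂μ = 0)
    (a : Fin K → ℝ) :
    ∫ ω, (∑ k, a k * (F k ω * V k ω) + Z ω) ^ 2 ∂μ =
      ∑ k, a k ^ 2 * ∫ ω, F k ω ^ 2 ∂μ + ∫ ω, Z ω ^ 2 ∂μ := by
  have hmean : ∀ o, ∫ ω, signedTerm F V Z a o ω ∂μ = 0 := by
    rintro (_ | k)
    · exact hZ0
    · simp only [signedTerm]
      rw [integral_const_mul, (indepFun_sign hind k).integral_fun_mul_eq_mul_integral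
        (hF k).aestronglyMeasurable (hV k).aestronglyMeasurable, hF0, zero_mul, mul_zero]
  have hs := hasSubgaussianMGF_signedTerm hind hV hFs hZs hV1 a
  have hvar := IndepFun.variance_sum (s := Finset.univ) (X := signedTerm F V Z a) (μ := μ)
    (fun o _ => (hs o).memLp 2)
    fun o _ o' _ h => (iIndepFun_signedTerm hind hF hV hZ a).indepFun h
  have hsum : (∑ o, signedTerm F V Z a o) = fun ω => ∑ k, a k * (F k ω * V k ω) + Z ω := by
    ext ω
    rw [Finset.sum_apply, sum_signedTerm]
  have hmean' : ∫ ω, (∑ k, a k * (F k ω * V k ω) + Z ω) ∂μ = 0 := by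
    simp_rw [← sum_signedTerm F V Z a]
    rw [integral_finsetSum _ fun o _ => (hs o).integrable]
    simp [hmean]
  rw [hsum, variance_of_integral_eq_zero
    (hasSubgaussianMGF_signedSum hind hF hV hZ hFs hZs hV1 a).aemeasurable hmean'] at hvar
  rw [hvar, Fintype.sum_option, add_comm]
  congr 1
  · refine Finset.sum_congr rfl fun k _ => ?_
    rw [variance_of_integral_eq_zero (hs (some k)).aemeasurable (hmean _), ← integral_const_mul]
    refine integral_congr_ae ?_
    filter_upwards [hV1 k] with ω h
    have : V k ω ^ 2 = 1 := by rcases h with h | h <;> simp [h]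
    simp [signedTerm, mul_pow, this]
  · exact variance_of_integral_eq_zero (hs none).aemeasurable (hmean _)

end SignedSum

/-! ### The random sources of the channel -/

section Sources

variable {Ω : Type*} {K : ℕ} (H : ℕ → Fin K → Ω → ℂ) (N : ℕ → Ω → ℂ) (U : ℕ → Fin K → Ω → ℝ)

/-- The information contained in a set of sources. -/
abbrev sourceAlgebra (S : Set (ℕ × Source K)) : MeasurableSpace Ω :=
  ⨆ i ∈ S, MeasurableSpace.comap (sourceVar H N U i) inferInstance

theorem sourceAlgebra_mono {S T : Set (ℕ × Source K)} (h : S ⊆ T) :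
    sourceAlgebra H N U S ≤ sourceAlgebra H N U T :=
  biSup_mono fun _ hi => h hi

/-- The channel output if agent `k` transmits the encoding of `a k`. -/
noncomputable def sumOutput (P : ℝ) (a : Fin K → ℝ) (t : ℕ) (ω : Ω) : ℂ :=
  channelOutput H N t (fun k => sumEncode P (a k) (U t k ω)) ω

theorem sumOutput_re (P : ℝ) (a : Fin K → ℝ) (t : ℕ) (ω : Ω) :
    (sumOutput H N U P a t ω).re =
      ∑ k, √(P * a k) * ((H t k ω).re * U t k ω) + (N t ω).re := by
  simp only [sumOutput, channelOutput, sumEncode, Complex.add_re, Complex.re_sum,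
    Complex.re_mul_ofReal]
  congr 1
  exact Finset.sum_congr rfl fun k _ => by ring

theorem sumOutput_im (P : ℝ) (a : Fin K → ℝ) (t : ℕ) (ω : Ω) :
    (sumOutput H N U P a t ω).im =
      ∑ k, √(P * a k) * ((H t k ω).im * U t k ω) + (N t ω).im := by
  simp only [sumOutput, channelOutput, sumEncode, Complex.add_im, Complex.im_sum,
    Complex.im_mul_ofReal]
  congr 1
  exact Finset.sum_congr rfl fun k _ => by ring

/-- The σ-algebra is left arbitrary, so that the result serves both the ambient one and those
generated by sets of sources. -/
theorem measurable_sumOutput_of_sourceVar [MeasurableSpace Ω] {t : ℕ}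
    (h : ∀ i, Measurable (sourceVar H N U (t, i))) (P : ℝ) (a : Fin K → ℝ) :
    Measurable (sumOutput H N U P a t) := by
  have h1 : ∀ k, Measurable fun ω => (H t k ω).re := fun k => h (.fadingRe k)
  have h2 : ∀ k, Measurable fun ω => (H t k ω).im := fun k => h (.fadingIm k)
  have h3 : Measurable fun ω => (N t ω).re := h .noiseRe
  have h4 : Measurable fun ω => (N t ω).im := h .noiseIm
  have h5 : ∀ k, Measurable fun ω => U t k ω := fun k => h (.sign k)
  have e : sumOutput H N U P a t = fun ω =>
      Complex.measurableEquivRealProd.symm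
        (∑ k, √(P * a k) * ((H t k ω).re * U t k ω) + (N t ω).re,
          ∑ k, √(P * a k) * ((H t k ω).im * U t k ω) + (N t ω).im) := by
    ext ω
    rw [← sumOutput_re, ← sumOutput_im]
    exact (Complex.measurableEquivRealProd.symm_apply_apply _).symm
  rw [e]
  refine (MeasurableEquiv.measurable _).comp (Measurable.prodMk ?_ ?_) <;> fun_prop

theorem measurable_sumOutput_sourceAlgebra {S : Set (ℕ × Source K)} {t : ℕ}
    (hS : ∀ i, (t, i) ∈ S) (P : ℝ) (a : Fin K → ℝ) :
    Measurable[sourceAlgebra H N U S] (sumOutput H N U P a t) := by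
  refine @measurable_sumOutput_of_sourceVar Ω K H N U (sourceAlgebra H N U S) t (fun i => ?_) P a
  refine (comap_measurable (sourceVar H N U (t, i))).mono ?_ le_rfl
  exact le_biSup (fun i => MeasurableSpace.comap (sourceVar H N U i) inferInstance) (hS i)

end Sources

section Channel

variable {Ω : Type*} [MeasurableSpace Ω] {μ : Measure Ω} {K : ℕ} {H : ℕ → Fin K → Ω → ℂ}
  {N : ℕ → Ω → ℂ} {U : ℕ → Fin K → Ω → ℝ} {σF σN : ℝ}

theorem IsFadingChannel.measurable_sourceVar (hc : IsFadingChannel μ H N U σF σN)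
    (i : ℕ × Source K) : Measurable (sourceVar H N U i) := by
  rcases i with ⟨t, k | k | _ | _ | k⟩
  · exact Complex.measurable_re.comp (hc.measurable_fading t k)
  · exact Complex.measurable_im.comp (hc.measurable_fading t k)
  · exact Complex.measurable_re.comp (hc.measurable_noise t)
  · exact Complex.measurable_im.comp (hc.measurable_noise t)
  · exact hc.measurable_sign t k

theorem IsFadingChannel.sourceAlgebra_le (hc : IsFadingChannel μ H N U σF σN)
    (S : Set (ℕ × Source K)) : sourceAlgebra H N U S ≤ ‹MeasurableSpace Ω› :=
  iSup₂_le fun i _ => (hc.measurable_sourceVar i).comap_le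

theorem IsFadingChannel.measurable_sumOutput (hc : IsFadingChannel μ H N U σF σN) (P : ℝ)
    (a : Fin K → ℝ) (t : ℕ) : Measurable (sumOutput H N U P a t) :=
  measurable_sumOutput_of_sourceVar H N U (fun i => hc.measurable_sourceVar (t, i)) P a

theorem IsFadingChannel.indep_sourceAlgebra (hc : IsFadingChannel μ H N U σF σN)
    {S T : Set (ℕ × Source K)} (hST : Disjoint S T) :
    Indep (sourceAlgebra H N U S) (sourceAlgebra H N U T) μ :=
  indep_iSup_of_disjoint (fun i => (hc.measurable_sourceVar i).comap_le) hc.indep.iIndep hST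

theorem IsFadingChannel.iIndep_sourceAlgebra (hc : IsFadingChannel μ H N U σF σN)
    {κ : Type*} {S : κ → Set (ℕ × Source K)} (hS : Pairwise fun i j => Disjoint (S i) (S j)) :
    iIndep (fun k => sourceAlgebra H N U (S k)) μ :=
  iIndep_iSup_of_pairwise_disjoint (fun i => (hc.measurable_sourceVar i).comap_le)
    hc.indep.iIndep hS

theorem IsFadingChannel.ae_sign [IsProbabilityMeasure μ] (hc : IsFadingChannel μ H N U σF σN)
    (t : ℕ) (k : Fin K) : ∀ᵐ ω ∂μ, U t k ω = 1 ∨ U t k ω = -1 := by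
  have hm : Measurable (U t k) := hc.measurable_sign t k
  have h1 : MeasurableSet {ω | U t k ω = 1} := hm (measurableSet_singleton 1)
  have h2 : MeasurableSet {ω | U t k ω = -1} := hm (measurableSet_singleton (-1))
  have hu : μ ({ω | U t k ω = 1} ∪ {ω | U t k ω = -1}) = 1 := by
    rw [measure_union _ h2, hc.sign_pos, hc.sign_neg, ENNReal.add_halves]
    rw [Set.disjoint_left]
    intro ω h h'
    simp only [Set.mem_ofPred_eq] at h h'
    rw [h] at h'
    norm_num at h'
  exact (prob_compl_eq_zero_iff (h1.union h2)).2 hu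

theorem sum_weight_mul_le {P : ℝ} (hP : 0 < P) {a : Fin K → ℝ} (ha0 : ∀ k, 0 ≤ a k)
    (ha1 : ∀ k, a k ≤ 1) {v : ℝ≥0} (hv : P * K * σF ^ 2 + σN ^ 2 ≤ v) (hσF : 0 ≤ σF)
    (hσN : 0 ≤ σN) :
    ∑ k, (√(P * a k) ^ 2).toNNReal * σF.toNNReal ^ 2 + σN.toNNReal ^ 2 ≤ v := by
  rw [← NNReal.coe_le_coe]
  push_cast
  rw [Real.coe_toNNReal _ hσF, Real.coe_toNNReal _ hσN]
  refine le_trans ?_ hv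
  gcongr
  calc ∑ k, (((√(P * a k) ^ 2).toNNReal : ℝ≥0) : ℝ) * σF ^ 2 ≤ ∑ _k : Fin K, P * σF ^ 2 := by
        gcongr with k
        have h := ha0 k
        rw [Real.coe_toNNReal _ (sq_nonneg _), Real.sq_sqrt (by positivity)]
        nlinarith [ha1 k]
    _ = P * K * σF ^ 2 := by simp; ring

variable [IsProbabilityMeasure μ]

/-- Handles real and imaginary part at once: `f` and `z` select the fading and noise sources, and
`hinj` says that these and the signs are distinct sources, hence independent. -/
theorem IsFadingChannel.sumOutput_part (hc : IsFadingChannel μ H N U σF σN) (hσF : 0 ≤ σF)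
    (hσN : 0 ≤ σN) {P : ℝ} (hP : 0 < P) {a : Fin K → ℝ} (ha0 : ∀ k, 0 ≤ a k)
    (ha1 : ∀ k, a k ≤ 1) {v : ℝ≥0} (hv : P * K * σF ^ 2 + σN ^ 2 ≤ v) (t : ℕ)
    {f : Fin K → Source K} {z : Source K}
    (hinj : Function.Injective (Sum.elim (Sum.elim f Source.sign) fun _ : Unit => z))
    (hf0 : ∀ k, ∫ ω, sourceVar H N U (t, f k) ω ∂μ = 0)
    (hfv : ∀ k, variance (sourceVar H N U (t, f k)) μ = 1)
    (hfs : ∀ k, subGaussianNorm (sourceVar H N U (t, f k)) μ ≤ ENNReal.ofReal σF)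
    (hz0 : ∫ ω, sourceVar H N U (t, z) ω ∂μ = 0)
    (hzs : subGaussianNorm (sourceVar H N U (t, z)) μ ≤ ENNReal.ofReal σN) :
    HasSubgaussianMGF (fun ω => ∑ k, √(P * a k) * (sourceVar H N U (t, f k) ω * U t k ω) +
        sourceVar H N U (t, z) ω) v μ ∧
      ∫ ω, (∑ k, √(P * a k) * (sourceVar H N U (t, f k) ω * U t k ω) +
        sourceVar H N U (t, z) ω) ^ 2 ∂μ =
        P * ∑ k, a k + ∫ ω, sourceVar H N U (t, z) ω ^ 2 ∂μ := by
  have hind : iIndepFun (Sum.elim (Sum.elim (fun k => sourceVar H N U (t, f k)) (U t))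
      fun _ : Unit => sourceVar H N U (t, z)) μ := by
    have := hc.indep.precomp (g := fun i =>
      (t, (Sum.elim (Sum.elim f Source.sign) fun _ : Unit => z) i))
      fun i j h => hinj (Prod.ext_iff.1 h).2
    convert this using 1
    ext i
    rcases i with (k | k) | k <;> rfl
  have hF : ∀ k, Measurable (sourceVar H N U (t, f k)) := fun k => hc.measurable_sourceVar _
  have hZ : Measurable (sourceVar H N U (t, z)) := hc.measurable_sourceVar _
  have hFs : ∀ k, HasSubgaussianMGF (sourceVar H N U (t, f k)) (σF.toNNReal ^ 2) μ := fun k =>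
    hasSubgaussianMGF_of_subGaussianNorm_le hσF (hf0 k) (hfs k)
  have hZs : HasSubgaussianMGF (sourceVar H N U (t, z)) (σN.toNNReal ^ 2) μ :=
    hasSubgaussianMGF_of_subGaussianNorm_le hσN hz0 hzs
  refine ⟨hasSubgaussianMGF_mono (hasSubgaussianMGF_signedSum hind hF (hc.measurable_sign t) hZ
    hFs hZs (hc.ae_sign t) fun k => √(P * a k))
    (sum_weight_mul_le hP ha0 ha1 hv hσF hσN), ?_⟩
  rw [integral_sq_signedSum hind hF (hc.measurable_sign t) hZ hFs hZs (hc.ae_sign t) hf0 hz0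
    fun k => √(P * a k), Finset.mul_sum]
  congr 1
  refine Finset.sum_congr rfl fun k _ => ?_
  rw [← variance_of_integral_eq_zero (hF k).aemeasurable (hf0 k), hfv,
    Real.sq_sqrt (mul_nonneg hP.le (ha0 k)), mul_one]

/-- Real and imaginary part contain the same signs, so their independence is not available. Instead,
`exp (x + y) ≤ (exp (2 * x) + exp (2 * y)) / 2` separates them; the doubled argument halves the
admissible range of `r` to `1 / (8 * v)` and turns the constant `16` into `64`. -/
theorem IsFadingChannel.mgf_energy_le (hc : IsFadingChannel μ H N U σF σN) (hσF : 0 ≤ σF)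
    (hσN : 0 ≤ σN) {P : ℝ} (hP : 0 < P) {a : Fin K → ℝ} (ha0 : ∀ k, 0 ≤ a k)
    (ha1 : ∀ k, a k ≤ 1) {v : ℝ≥0} (hv0 : 0 < v) (hv : P * K * σF ^ 2 + σN ^ 2 ≤ v) (t : ℕ)
    {r : ℝ} (hr : |r| ≤ 1 / (8 * v)) :
    Integrable (fun ω => Real.exp (r * (‖sumOutput H N U P a t ω‖ ^ 2 -
        (2 * P * ∑ k, a k + ∫ ω, ‖N t ω‖ ^ 2 ∂μ)))) μ ∧
      ∫ ω, Real.exp (r * (‖sumOutput H N U P a t ω‖ ^ 2 -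
        (2 * P * ∑ k, a k + ∫ ω, ‖N t ω‖ ^ 2 ∂μ))) ∂μ ≤ Real.exp (64 * v ^ 2 * r ^ 2) := by
  have hv' : (0 : ℝ) < v := hv0
  obtain ⟨s1, e1⟩ := hc.sumOutput_part hσF hσN hP ha0 ha1 hv t (f := .fadingRe) (z := .noiseRe)
    (by rintro ((i | i) | i) ((j | j) | j) <;> simp) (hc.fading_mean_re t) (hc.fading_var_re t)
    (hc.fading_norm_re t) (hc.noise_mean_re t) (hc.noise_norm_re t)
  obtain ⟨s2, e2⟩ := hc.sumOutput_part hσF hσN hP ha0 ha1 hv t (f := .fadingIm) (z := .noiseIm)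
    (by rintro ((i | i) | i) ((j | j) | j) <;> simp) (hc.fading_mean_im t) (hc.fading_var_im t)
    (hc.fading_norm_im t) (hc.noise_mean_im t) (hc.noise_norm_im t)
  simp only [sourceVar, ← sumOutput_re, ← sumOutput_im] at s1 e1 s2 e2
  have hm := hc.measurable_sumOutput P a t
  have hr2 : |2 * r| ≤ 1 / (4 * v) := by
    rw [abs_mul, abs_two]
    calc 2 * |r| ≤ 2 * (1 / (8 * v)) := by gcongr
      _ = 1 / (4 * v) := by field_simp; norm_num
  obtain ⟨i1, b1⟩ := mgf_sq_sub_integral_le (Complex.measurable_re.comp hm) hv0 s1 hr2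
  obtain ⟨i2, b2⟩ := mgf_sq_sub_integral_le (Complex.measurable_im.comp hm) hv0 s2 hr2
  simp only [Function.comp_apply] at i1 b1 i2 b2
  have hN : ∫ ω, ‖N t ω‖ ^ 2 ∂μ = ∫ ω, (N t ω).re ^ 2 ∂μ + ∫ ω, (N t ω).im ^ 2 ∂μ := by
    rw [← integral_add]
    · refine integral_congr_ae (ae_of_all _ fun ω => ?_)
      simp only [Complex.sq_norm, Complex.normSq_apply]
      ring
    · exact integrable_sq_of_hasSubgaussianMGF
        (hasSubgaussianMGF_of_subGaussianNorm_le hσN (hc.noise_mean_re t) (hc.noise_norm_re t))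
    · exact integrable_sq_of_hasSubgaussianMGF
        (hasSubgaussianMGF_of_subGaussianNorm_le hσN (hc.noise_mean_im t) (hc.noise_norm_im t))
  have hpt : ∀ ω, Real.exp (r * (‖sumOutput H N U P a t ω‖ ^ 2 -
      (2 * P * ∑ k, a k + ∫ ω, ‖N t ω‖ ^ 2 ∂μ))) ≤
      (Real.exp (2 * r * ((sumOutput H N U P a t ω).re ^ 2 -
          ∫ ω, (sumOutput H N U P a t ω).re ^ 2 ∂μ)) +
        Real.exp (2 * r * ((sumOutput H N U P a t ω).im ^ 2 -
          ∫ ω, (sumOutput H N U P a t ω).im ^ 2 ∂μ))) / 2 := by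
    intro ω
    rw [e1, e2, hN, Complex.sq_norm, Complex.normSq_apply]
    set x := r * ((sumOutput H N U P a t ω).re ^ 2 -
      (P * ∑ k, a k + ∫ ω, (N t ω).re ^ 2 ∂μ)) with hx
    set y := r * ((sumOutput H N U P a t ω).im ^ 2 -
      (P * ∑ k, a k + ∫ ω, (N t ω).im ^ 2 ∂μ)) with hy
    have E0 : r * ((sumOutput H N U P a t ω).re * (sumOutput H N U P a t ω).re +
        (sumOutput H N U P a t ω).im * (sumOutput H N U P a t ω).im -
        (2 * P * ∑ k, a k + (∫ ω, (N t ω).re ^ 2 ∂μ + ∫ ω, (N t ω).im ^ 2 ∂μ))) = x + y := by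
      rw [hx, hy]; ring
    rw [E0, mul_assoc 2 r, mul_assoc 2 r, ← hx, ← hy, Real.exp_add, two_mul, two_mul,
      Real.exp_add, Real.exp_add]
    nlinarith [sq_nonneg (Real.exp x - Real.exp y)]
  have i3 := (i1.add i2).div_const 2
  have i0 : Integrable (fun ω => Real.exp (r * (‖sumOutput H N U P a t ω‖ ^ 2 -
      (2 * P * ∑ k, a k + ∫ ω, ‖N t ω‖ ^ 2 ∂μ)))) μ := by
    refine i3.mono' (by fun_prop) (ae_of_all _ fun ω => ?_)
    rw [Real.norm_of_nonneg (Real.exp_pos _).le]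
    exact hpt ω
  refine ⟨i0, (integral_mono i0 i3 hpt).trans ?_⟩
  simp only [Pi.add_apply]
  rw [integral_div, integral_add i1 i2]
  have E1 : 16 * (v : ℝ) ^ 2 * (2 * r) ^ 2 = 64 * v ^ 2 * r ^ 2 := by ring
  rw [E1] at b1 b2
  linarith

end Channel

/-! ### Approximation error of the sum function -/

section Deviation

variable {Ω : Type*} [MeasurableSpace Ω] {μ : Measure Ω}

/-- Chernoff's bound for both tails; the moment generating functions are needed only at `r` and
`-r`, since `r` is fixed beforehand. -/
theorem measureReal_le_abs_sum_le [IsProbabilityMeasure μ] {M : ℕ} {X : Fin M → Ω → ℝ}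
    (hind : iIndepFun X μ) (hX : ∀ i, Measurable (X i)) {r B : ℝ} (hr : 0 ≤ r)
    (hint : ∀ i, ∀ r', |r'| = r → Integrable (fun ω => Real.exp (r' * X i ω)) μ)
    (hmgf : ∀ i, ∀ r', |r'| = r → mgf (X i) μ r' ≤ Real.exp B) (D : ℝ) :
    μ.real {ω | D ≤ |∑ i, X i ω|} ≤ 2 * Real.exp (-(r * D) + M * B) := by
  have hm : ∀ r', |r'| = r → mgf (∑ i, X i) μ r' ≤ Real.exp (M * B) := by
    intro r' hr'
    rw [hind.mgf_sum hX]
    calc ∏ i, mgf (X i) μ r' ≤ ∏ _i : Fin M, Real.exp B :=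
          Finset.prod_le_prod (fun i _ => mgf_nonneg) fun i _ => hmgf i r' hr'
      _ = Real.exp (M * B) := by
        rw [Finset.prod_const, Finset.card_univ, Fintype.card_fin, ← Real.exp_nat_mul]
  have hi : ∀ r', |r'| = r → Integrable (fun ω => Real.exp (r' * (∑ i, X i) ω)) μ :=
    fun r' hr' => hind.integrable_exp_mul_sum hX fun i _ => hint i r' hr'
  have hpos : |r| = r := abs_of_nonneg hr
  have hneg : |-r| = r := by rw [abs_neg, hpos]
  have h1 := measure_ge_le_exp_mul_mgf (X := ∑ i, X i) (μ := μ) D hr (hi r hpos)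
  have h2 := measure_le_le_exp_mul_mgf (X := ∑ i, X i) (μ := μ) (-D) (neg_nonpos.2 hr)
    (hi (-r) hneg)
  have hsub : {ω | D ≤ |∑ i, X i ω|} ⊆
      {ω | D ≤ (∑ i, X i) ω} ∪ {ω | (∑ i, X i) ω ≤ -D} := by
    intro ω hω
    simp only [Set.mem_ofPred_eq, Set.mem_union, Finset.sum_apply] at hω ⊢
    rcases le_abs.1 hω with h | h
    · exact Or.inl h
    · exact Or.inr (by linarith)
  refine (measureReal_mono hsub).trans ((measureReal_union_le _ _).trans ?_)
  have h3 : Real.exp (-r * D) * mgf (∑ i, X i) μ r ≤ Real.exp (-(r * D) + M * B) := by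
    rw [Real.exp_add, neg_mul]
    gcongr
    exact hm r hpos
  have h4 : Real.exp (-(-r) * -D) * mgf (∑ i, X i) μ (-r) ≤ Real.exp (-(r * D) + M * B) := by
    rw [Real.exp_add, neg_neg, mul_neg]
    gcongr
    exact hm (-r) hneg
  linarith

variable {K : ℕ} {H : ℕ → Fin K → Ω → ℂ} {N : ℕ → Ω → ℂ} {U : ℕ → Fin K → Ω → ℝ} {σF σN : ℝ}

theorem IsFadingChannel.iIndepFun_energy (hc : IsFadingChannel μ H N U σF σN) (P : ℝ)
    (a : Fin K → ℝ) (c : ℕ → ℝ) :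
    iIndepFun (fun (t : ℕ) ω => ‖sumOutput H N U P a t ω‖ ^ 2 - c t) μ := by
  have hS : Pairwise fun t t' : ℕ =>
      Disjoint {i : ℕ × Source K | i.1 = t} {i : ℕ × Source K | i.1 = t'} := by
    intro t t' h
    rw [Set.disjoint_left]
    intro i hi hi'
    exact h (hi.symm.trans hi')
  refine iIndep_of_iIndep_of_le (hc.iIndep_sourceAlgebra hS) fun t => Measurable.comap_le ?_
  have := measurable_sumOutput_sourceAlgebra H N U (S := {i : ℕ × Source K | i.1 = t}) (t := t)
    (fun i => rfl) P a
  exact ((measurable_norm.pow_const 2).sub_const (c t)).comp this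

/-- The second exponential of the bound alone suffices, because `2 * w ≤ L`. -/
theorem sumErrorBound_ge {M K : ℕ} {σF σN P ε : ℝ} (hσF : 0 ≤ σF) (hσN : 0 ≤ σN)
    (hP : 0 < P) (hε : 0 < ε) {w : ℝ} (hw0 : 0 < w) (hw : w = K * σF ^ 2 + σN ^ 2 / P) :
    2 * Real.exp (-(M * ε ^ 2 / (8 * w * ε + 64 * w ^ 2))) ≤ sumErrorBound M K σF σN P ε := by
  unfold sumErrorBound
  set L : ℝ := 3 * σF ^ 2 * K + 4 * σN * σF * √K / √P + 2 * σN ^ 2 / P with hL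
  have hwL : 2 * w ≤ L := by
    have h1 : 0 ≤ σF ^ 2 * K := by positivity
    have h2 : 0 ≤ 4 * σN * σF * √K / √P := by positivity
    have h3 : 2 * σN ^ 2 / P = 2 * (σN ^ 2 / P) := by ring
    rw [hw, hL, h3]
    linarith
  have hq : 8 * w * ε + 64 * w ^ 2 ≤ 4 * L * ε + 16 * L ^ 2 := by
    have h1 : 2 * w * ε ≤ L * ε := by gcongr
    have h2 : (2 * w) ^ 2 ≤ L ^ 2 := by gcongr
    nlinarith
  have : 2 * Real.exp (-(M * ε ^ 2 / (8 * w * ε + 64 * w ^ 2))) ≤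
      2 * Real.exp (-(M * ε ^ 2 / (4 * L * ε + 16 * L ^ 2))) := by
    gcongr
  refine this.trans (le_add_of_nonneg_left (by positivity))

/-- Over `M` uses of the channel the sum function is approximated up to an error below `ε`, except
on an event with probability at most `sumErrorBound`. -/
theorem IsFadingChannel.measureReal_sumDecode_error_le [IsProbabilityMeasure μ]
    (hc : IsFadingChannel μ H N U σF σN) (hσF : 0 < σF) (hσN : 0 ≤ σN)
    (hK : 0 < K) {P : ℝ} (hP : 0 < P) {a : Fin K → ℝ} (ha0 : ∀ k, 0 ≤ a k) (ha1 : ∀ k, a k ≤ 1) {M : ℕ} (hM : 0 < M) {τ : Fin M → ℕ}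
    (hτ : Function.Injective τ) {ε : ℝ} (hε : 0 < ε) :
    μ.real {ω | ε ≤ |sumDecode P (fun i => ∫ ω, ‖N (τ i) ω‖ ^ 2 ∂μ)
      (fun i => sumOutput H N U P a (τ i) ω) - ∑ k, a k|} ≤ sumErrorBound M K σF σN P ε := by
  have hKr : (0 : ℝ) < K := by exact_mod_cast hK
  have hMr : (0 : ℝ) < M := by exact_mod_cast hM
  set w : ℝ := K * σF ^ 2 + σN ^ 2 / P with hw
  have hw0 : 0 < w := by positivity
  refine le_trans ?_ (sumErrorBound_ge hσF.le hσN hP hε hw0 hw)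
  set q : ℝ := 8 * w * ε + 64 * w ^ 2 with hq
  have hq0 : 0 < q := by positivity
  set v : ℝ≥0 := (P * w).toNNReal with hv
  have hvr : (v : ℝ) = P * w := Real.coe_toNNReal _ (by positivity)
  have hv0 : 0 < v := by
    rw [hv, Real.toNNReal_pos]; positivity
  have hv1 : P * K * σF ^ 2 + σN ^ 2 ≤ v := by
    rw [hvr, hw]
    apply le_of_eq
    field_simp
  -- A near-optimal Chernoff parameter. The summand `8 * w * ε` of `q` keeps `r` below `1 / (8 *
  -- v)`; the summand `64 * w ^ 2` makes the quadratic term consume at most half of the linear gain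
  -- `2 * M * ε ^ 2 / q`.
  set r : ℝ := ε / (P * q) with hr
  have hr0 : 0 ≤ r := by positivity
  have hr1 : r ≤ 1 / (8 * v) := by
    rw [hr, hvr, div_le_div_iff₀ (by positivity) (by positivity), hq]
    nlinarith [mul_pos hP (pow_pos hw0 2)]
  set c : ℕ → ℝ := fun t => 2 * P * ∑ k, a k + ∫ ω, ‖N t ω‖ ^ 2 ∂μ with hcdef
  have hmg := fun t r' (h : |r'| = r) =>
    hc.mgf_energy_le hσF.le hσN hP ha0 ha1 hv0 hv1 t (h.trans_le hr1)
  have hind : iIndepFun (fun i ω => ‖sumOutput H N U P a (τ i) ω‖ ^ 2 - c (τ i)) μ :=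
    (hc.iIndepFun_energy P a c).precomp hτ
  have hdev := measureReal_le_abs_sum_le hind (B := 64 * v ^ 2 * r ^ 2)
    (fun i => ((hc.measurable_sumOutput P a (τ i)).norm.pow_const 2).sub_const _) hr0
    (fun i r' h => (hmg (τ i) r' h).1)
    (fun i r' h => by
      have hb := (hmg (τ i) r' h).2
      have : r' ^ 2 = r ^ 2 := by rw [← sq_abs, h]
      rwa [this] at hb) (2 * M * P * ε)
  have hset : {ω | ε ≤ |sumDecode P (fun i => ∫ ω, ‖N (τ i) ω‖ ^ 2 ∂μ)
      (fun i => sumOutput H N U P a (τ i) ω) - ∑ k, a k|} =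
      {ω | 2 * M * P * ε ≤ |∑ i, (‖sumOutput H N U P a (τ i) ω‖ ^ 2 - c (τ i))|} := by
    ext ω
    have : sumDecode P (fun i => ∫ ω, ‖N (τ i) ω‖ ^ 2 ∂μ)
        (fun i => sumOutput H N U P a (τ i) ω) - ∑ k, a k =
        (∑ i, (‖sumOutput H N U P a (τ i) ω‖ ^ 2 - c (τ i))) / (2 * M * P) := by
      rw [sumDecode, hcdef]
      simp only [Finset.sum_sub_distrib, Finset.sum_add_distrib, Finset.sum_const,
        Finset.card_univ, Fintype.card_fin, nsmul_eq_mul]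
      field_simp
      ring
    have hpos : (0 : ℝ) < 2 * M * P := by positivity
    rw [Set.mem_ofPred_eq, Set.mem_ofPred_eq, this, abs_div, abs_of_pos hpos, le_div_iff₀' hpos]
  rw [hset]
  refine hdev.trans ?_
  gcongr
  have hq1 : 64 * w ^ 2 ≤ q := by rw [hq]; nlinarith [mul_pos hw0 hε]
  have e1 : -(r * (2 * M * P * ε)) + M * (64 * v ^ 2 * r ^ 2) =
      -(2 * (M * ε ^ 2 / q)) + M * ε ^ 2 / q * (64 * w ^ 2 / q) := by
    rw [hr, hvr]
    field_simp
  have h2 : 64 * w ^ 2 / q ≤ 1 := (div_le_one hq0).2 hq1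
  have h3 : 0 ≤ M * ε ^ 2 / q := by positivity
  rw [e1]
  nlinarith [mul_le_mul_of_nonneg_left h2 h3]

end Deviation

/-! ### Adaptively chosen events -/

/-- Split `A` by the value of `f`. On each piece the event `G h` is a fixed one, independent of the
piece, so the factor `c` comes out; countability allows the summation. -/
theorem mul_measure_le_measure_adaptive {Ω β : Type*} [Countable β]
    {m₁ m₂ mΩ : MeasurableSpace Ω} {μ : Measure Ω} (h₁ : m₁ ≤ mΩ) (h₂ : m₂ ≤ mΩ)
    (hind : Indep m₁ m₂ μ) {A : Set Ω} {f : Ω → β}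
    (hA : ∀ h, MeasurableSet[m₁] (A ∩ {ω | f ω = h})) {G : β → Set Ω}
    (hG : ∀ h, MeasurableSet[m₂] (G h)) {c : ℝ≥0∞} (hc : ∀ h, c ≤ μ (G h)) :
    c * μ A ≤ μ {ω | ω ∈ A ∧ ω ∈ G (f ω)} := by
  have e1 : A = ⋃ h, A ∩ {ω | f ω = h} := by
    ext ω; simp
  have e2 : {ω | ω ∈ A ∧ ω ∈ G (f ω)} = ⋃ h, (A ∩ {ω | f ω = h}) ∩ G h := by
    ext ω
    simp only [Set.mem_ofPred_eq, Set.mem_iUnion, Set.mem_inter_iff]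
    exact ⟨fun h => ⟨f ω, ⟨h.1, rfl⟩, h.2⟩, fun ⟨h, ⟨h1, h2⟩, h3⟩ => ⟨h1, h2 ▸ h3⟩⟩
  have hd : Pairwise fun h h' => Disjoint (A ∩ {ω | f ω = h}) (A ∩ {ω | f ω = h'}) := by
    intro h h' hne
    rw [Set.disjoint_left]
    rintro ω ⟨-, h1⟩ ⟨-, h2⟩
    exact hne (h1.symm.trans h2)
  calc c * μ A = ∑' h, c * μ (A ∩ {ω | f ω = h}) := by
        rw [ENNReal.tsum_mul_left, ← measure_iUnion hd fun h => h₁ _ (hA h), ← e1]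
    _ ≤ ∑' h, μ ((A ∩ {ω | f ω = h}) ∩ G h) := by
        refine ENNReal.tsum_le_tsum fun h => ?_
        rw [(Indep_iff _ _ μ).1 hind _ _ (hA h) (hG h), mul_comm]
        gcongr
        exact hc h
    _ = μ {ω | ω ∈ A ∧ ω ∈ G (f ω)} := by
        rw [e2, measure_iUnion]
        · exact fun h h' hne => (hd hne).mono Set.inter_subset_left Set.inter_subset_left
        · exact fun h => (h₁ _ (hA h)).inter (h₂ _ (hG h))

/-! ### The estimates of the coordinator -/

instance : Countable Message :=
  Function.Injective.countable (f := fun c : Message => match c with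
    | .append b => (Sum.inl b : Bool ⊕ Bool)
    | .finish b => Sum.inr b) <| by
    rintro (a | a) (b | b) h <;> simp_all

instance : MeasurableSpace Message := ⊤

theorem measurable_react (m : ℕ) : Measurable (react m) := by
  unfold react
  refine Measurable.ite (measurableSet_le (by fun_prop) (by fun_prop)) measurable_const ?_
  refine Measurable.ite (measurableSet_lt (by fun_prop) (by fun_prop)) measurable_const ?_
  exact Measurable.ite (measurableSet_le (by fun_prop) (by fun_prop)) measurable_const
    measurable_const

section Estimates

variable {Ω : Type*} {K : ℕ} (M : ℕ) (P : ℝ) (ν : ℕ → ℝ) (b : Fin K → Lex (ℕ → Bool))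
  (H : ℕ → Fin K → Ω → ℂ) (N : ℕ → Ω → ℂ) (U : ℕ → Fin K → Ω → ℝ)

open Classical in
/-- The indicator function of the agents which answer question `q` in the affirmative. -/
noncomputable def queryIndicator (x : List Bool) (q : Fin 3) (k : Fin K) : ℝ :=
  if Query x (b k) q then 1 else 0

/-- The channel use that is number `i` among those for question `q` in step `j`. -/
def useIndex (j : ℕ) (q : Fin 3) (i : Fin M) : ℕ :=
  3 * M * j + (finProdFinEquiv (q, i) : Fin (3 * M))

/-- The estimate for question `q` about the word `x` that is obtained from the channel uses of
step `j`. -/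
noncomputable def estimate (j : ℕ) (x : List Bool) (q : Fin 3) (ω : Ω) : ℝ :=
  sumDecode P (fun i => ν (useIndex M j q i))
    (fun i => sumOutput H N U P (queryIndicator b x q) (useIndex M j q i) ω)

theorem useIndex_inj {j j' : ℕ} {q q' : Fin 3} {i i' : Fin M}
    (h : useIndex M j q i = useIndex M j' q' i') : j = j' ∧ q = q' ∧ i = i' := by
  unfold useIndex at h
  set u : Fin (3 * M) := finProdFinEquiv (q, i) with hu
  set u' : Fin (3 * M) := finProdFinEquiv (q', i') with hu'
  have hj : j = j' := by
    have h1 : (3 * M * j + u) / (3 * M) = j := by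
      rw [Nat.mul_add_div (by have := u.2; omega), Nat.div_eq_of_lt u.2, add_zero]
    have h2 : (3 * M * j' + u') / (3 * M) = j' := by
      rw [Nat.mul_add_div (by have := u.2; omega), Nat.div_eq_of_lt u'.2, add_zero]
    rw [← h1, h, h2]
  subst hj
  have : u = u' := Fin.ext (by omega)
  rw [hu, hu'] at this
  simpa using this

theorem le_useIndex (j : ℕ) (q : Fin 3) (i : Fin M) : 3 * M * j ≤ useIndex M j q i :=
  Nat.le_add_right _ _

theorem useIndex_lt (j : ℕ) (q : Fin 3) (i : Fin M) : useIndex M j q i < 3 * M * (j + 1) := by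
  unfold useIndex
  have := (finProdFinEquiv (q, i) : Fin (3 * M)).2
  rw [mul_add, mul_one]
  omega

theorem measurable_estimate {S : Set (ℕ × Source K)} {j : ℕ} {q : Fin 3}
    (hS : ∀ i c, (useIndex M j q i, c) ∈ S) (x : List Bool) :
    Measurable[sourceAlgebra H N U S] (estimate M P ν b H N U j x q) := by
  have h1 : Measurable fun y : Fin M → ℂ => sumDecode P (fun i => ν (useIndex M j q i)) y := by
    unfold sumDecode
    fun_prop
  exact h1.comp (@measurable_pi_lambda _ _ _ (sourceAlgebra H N U S) _ _ fun i =>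
    measurable_sumOutput_sourceAlgebra H N U (hS i) P _)

/-- The event that all three estimates in step `j` about the word `x` have an error below `ε`. -/
def accurate (ε : ℝ) (j : ℕ) (x : List Bool) : Set Ω :=
  {ω | ∀ q, |estimate M P ν b H N U j x q ω - ∑ k, queryIndicator b x q k| < ε}

theorem measurableSet_estimate_error {S : Set (ℕ × Source K)} {j : ℕ} {q : Fin 3}
    (hS : ∀ i c, (useIndex M j q i, c) ∈ S) (ε : ℝ) (x : List Bool) :
    MeasurableSet[sourceAlgebra H N U S]
      {ω | |estimate M P ν b H N U j x q ω - ∑ k, queryIndicator b x q k| < ε} := by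
  have h1 : MeasurableSet {e : ℝ | |e - ∑ k, queryIndicator b x q k| < ε} :=
    measurableSet_lt (by fun_prop) (by fun_prop)
  exact measurable_estimate M P ν b H N U hS x h1

theorem measurableSet_accurate {S : Set (ℕ × Source K)} {j : ℕ}
    (hS : ∀ q i c, (useIndex M j q i, c) ∈ S) (ε : ℝ) (x : List Bool) :
    MeasurableSet[sourceAlgebra H N U S] (accurate M P ν b H N U ε j x) := by
  have : accurate M P ν b H N U ε j x = ⋂ q,
      {ω | |estimate M P ν b H N U j x q ω - ∑ k, queryIndicator b x q k| < ε} := by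
    ext ω; simp [accurate]
  rw [this]
  exact MeasurableSet.iInter fun q => measurableSet_estimate_error M P ν b H N U (hS q) ε x

end Estimates

theorem queryIndicator_nonneg {K : ℕ} (b : Fin K → Lex (ℕ → Bool)) (x : List Bool) (q : Fin 3)
    (k : Fin K) : 0 ≤ queryIndicator b x q k := by
  unfold queryIndicator; split_ifs <;> norm_num

theorem queryIndicator_le_one {K : ℕ} (b : Fin K → Lex (ℕ → Bool)) (x : List Bool) (q : Fin 3)
    (k : Fin K) : queryIndicator b x q k ≤ 1 := by
  unfold queryIndicator; split_ifs <;> norm_num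

/-- For a fixed word, the three questions use disjoint blocks of channel uses, so their error events
are independent and the success probabilities multiply. -/
theorem IsFadingChannel.le_measure_accurate {Ω : Type*} [MeasurableSpace Ω] {μ : Measure Ω}
    [IsProbabilityMeasure μ] {K : ℕ} {H : ℕ → Fin K → Ω → ℂ} {N : ℕ → Ω → ℂ}
    {U : ℕ → Fin K → Ω → ℝ} {σF σN : ℝ} (hc : IsFadingChannel μ H N U σF σN)
    (hσF : 0 < σF) (hσN : 0 ≤ σN) (hK : 0 < K) {P : ℝ} (hP : 0 < P) {M : ℕ} (hM : 0 < M)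
    {ε : ℝ} (hε : 0 < ε) (b : Fin K → Lex (ℕ → Bool)) (j : ℕ) (x : List Bool) :
    ENNReal.ofReal (1 - sumErrorBound M K σF σN P ε) ^ 3 ≤
      μ (accurate M P (fun t => ∫ ω, ‖N t ω‖ ^ 2 ∂μ) b H N U ε j x) := by
  set ν : ℕ → ℝ := fun t => ∫ ω, ‖N t ω‖ ^ 2 ∂μ with hν
  let S : Fin 3 → Set (ℕ × Source K) := fun q => {c | ∃ i, c.1 = useIndex M j q i}
  have hS : Pairwise fun q q' => Disjoint (S q) (S q') := by
    intro q q' hne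
    rw [Set.disjoint_left]
    rintro c ⟨i, hi⟩ ⟨i', hi'⟩
    exact hne (useIndex_inj M (hi.symm.trans hi')).2.1
  have hmem : ∀ q i c, (useIndex M j q i, c) ∈ S q := fun q i c => ⟨i, rfl⟩
  have e : accurate M P ν b H N U ε j x = ⋂ q,
      {ω | |estimate M P ν b H N U j x q ω - ∑ k, queryIndicator b x q k| < ε} := by
    ext ω; simp [accurate]
  have hm := fun q => measurableSet_estimate_error M P ν b H N U (hmem q) ε x
  rw [e, (hc.iIndep_sourceAlgebra hS).meas_iInter hm]
  calc ENNReal.ofReal (1 - sumErrorBound M K σF σN P ε) ^ 3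
      = ∏ _q : Fin 3, ENNReal.ofReal (1 - sumErrorBound M K σF σN P ε) := by simp
    _ ≤ _ := Finset.prod_le_prod' fun q _ => ?_
  have herr := hc.measureReal_sumDecode_error_le hσF hσN hK hP
    (queryIndicator_nonneg b x q) (queryIndicator_le_one b x q) hM (τ := useIndex M j q)
    (fun i i' h => (useIndex_inj M h).2.2) hε
  have hcompl := probReal_compl_eq_one_sub (μ := μ) (hc.sourceAlgebra_le _ _ (hm q))
  have hset : {ω | |estimate M P ν b H N U j x q ω - ∑ k, queryIndicator b x q k| < ε}ᶜ =
      {ω | ε ≤ |sumDecode P (fun i => ∫ ω, ‖N (useIndex M j q i) ω‖ ^ 2 ∂μ)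
        (fun i => sumOutput H N U P (queryIndicator b x q) (useIndex M j q i) ω) -
          ∑ k, queryIndicator b x q k|} := by
    ext ω
    simp only [Set.mem_compl_iff, Set.mem_ofPred_eq, not_lt]
    rfl
  rw [hset] at hcompl
  refine ENNReal.ofReal_le_of_le_toReal ?_
  change _ ≤ μ.real _
  linarith

/-! ### The transcript of ScalableMax -/

section Transcript

variable {Ω α : Type*} {K : ℕ} (M m : ℕ) (φ : α → Lex (ℕ → Bool)) (P : ℝ) (ν : ℕ → ℝ)
  (s : Fin K → α) (H : ℕ → Fin K → Ω → ℂ) (N : ℕ → Ω → ℂ) (U : ℕ → Fin K → Ω → ℝ)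

/-- The multicasts of ScalableMax after one more step, if those so far are `h`. -/
noncomputable def nextTranscript (h : List Message) (ω : Ω) : List Message :=
  if (scalableMax K M m φ P ν).halted h then h
  else h ++ [react m fun q =>
    estimate M P ν (fun k => φ (s k)) H N U h.length (currentWord h) q ω]

theorem multicast_eq_react_estimate (h : List Message) (ω : Ω) :
    ((scalableMax K M m φ P ν).multicast h fun i =>
      channelOutput H N ((scalableMax K M m φ P ν).uses * h.length + i)
        (fun k => (scalableMax K M m φ P ν).transmitted s U h i k ω) ω) =
      react m fun q =>
        estimate M P ν (fun k => φ (s k)) H N U h.length (currentWord h) q ω := by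
  -- The numbering of the uses in the protocol agrees definitionally with `useIndex`; it remains to
  -- identify the transmitted symbols.
  change react m (fun q => sumDecode P (fun i => ν (useIndex M h.length q i)) fun i : Fin M =>
    channelOutput H N (useIndex M h.length q i) (fun k => (scalableMax K M m φ P ν).transmitted
      s U h (finProdFinEquiv (q, i) : Fin (3 * M)) k ω) ω) = _
  refine congrArg (react m) (funext fun q => ?_)
  refine congrArg (sumDecode P _) (funext fun i => ?_)
  refine congrArg (fun x => channelOutput H N (useIndex M h.length q i) x ω) (funext fun k => ?_)
  refine congrArg (fun a => sumEncode P a (U (useIndex M h.length q i) k ω)) ?_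
  rw [queryIndicator, Equiv.symm_apply_apply]

theorem transcript_succ (ω : Ω) (t : ℕ) :
    (scalableMax K M m φ P ν).transcript s H N U ω (t + 1) =
      nextTranscript M m φ P ν s H N U
        ((scalableMax K M m φ P ν).transcript s H N U ω t) ω := by
  rw [StarProtocol.transcript, nextTranscript, ← multicast_eq_react_estimate]

theorem length_transcript_le (ω : Ω) (t : ℕ) :
    ((scalableMax K M m φ P ν).transcript s H N U ω t).length ≤ t := by
  induction t with
  | zero => simp [StarProtocol.transcript]
  | succ t ih =>
    rw [transcript_succ, nextTranscript]
    split_ifs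
    · omega
    · simpa using ih

theorem measurableSet_nextTranscript_eq {S : Set (ℕ × Source K)} {h : List Message}
    (hS : ∀ q i c, (useIndex M h.length q i, c) ∈ S) (h' : List Message) :
    MeasurableSet[sourceAlgebra H N U S]
      {ω | nextTranscript M m φ P ν s H N U h ω = h'} := by
  unfold nextTranscript
  split_ifs
  · exact @MeasurableSet.const _ (sourceAlgebra H N U S) (h = h')
  · have h1 : Measurable[sourceAlgebra H N U S] fun ω => react m fun q =>
        estimate M P ν (fun k => φ (s k)) H N U h.length (currentWord h) q ω :=
      (measurable_react m).comp (@measurable_pi_lambda _ _ _ (sourceAlgebra H N U S) _ _ fun q =>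
        measurable_estimate M P ν _ H N U (hS q) _)
    have h2 : MeasurableSet {c : Message | h ++ [c] = h'} := trivial
    exact h1 h2

theorem measurableSet_transcript_eq (t : ℕ) (h : List Message) :
    MeasurableSet[sourceAlgebra H N U {i | i.1 < 3 * M * t}]
      {ω | (scalableMax K M m φ P ν).transcript s H N U ω t = h} := by
  induction t generalizing h with
  | zero =>
    simp only [StarProtocol.transcript]
    exact @MeasurableSet.const _ (sourceAlgebra H N U _) ([] = h)
  | succ t ih =>
    -- Only predecessors of length at most `t` may enter the union: the uses read after transcript
    -- `g` are those of step `g.length`, which must precede use `3 * M * (t + 1)`.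
    have e : {ω | (scalableMax K M m φ P ν).transcript s H N U ω (t + 1) = h} =
        ⋃ g : {g : List Message // g.length ≤ t},
          {ω | (scalableMax K M m φ P ν).transcript s H N U ω t = g} ∩
            {ω | nextTranscript M m φ P ν s H N U g ω = h} := by
      ext ω
      simp only [Set.mem_ofPred_eq, Set.mem_iUnion, Set.mem_inter_iff, transcript_succ]
      constructor
      · intro h1
        exact ⟨⟨_, length_transcript_le M m φ P ν s H N U ω t⟩, rfl, h1⟩
      · rintro ⟨g, h1, h2⟩
        rw [h1, h2]
    rw [e]
    refine MeasurableSet.iUnion fun g => MeasurableSet.inter ?_ ?_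
    · refine sourceAlgebra_mono H N U ?_ _ (ih g)
      intro i hi
      have hi : i.1 < 3 * M * t := hi
      exact hi.trans_le (Nat.mul_le_mul_left _ (Nat.le_succ t))
    · refine measurableSet_nextTranscript_eq M m φ P ν s H N U (fun q i c => ?_) h
      exact (useIndex_lt M _ q i).trans_le (Nat.mul_le_mul_left _ (Nat.succ_le_succ g.2))

/-- The event that the estimates of the first `J` steps are accurate; step `j` is about the word
that results from the first `j` steps. -/
def accurateUpTo (ε : ℝ) (J : ℕ) : Set Ω :=
  {ω | ∀ j < J, ω ∈ accurate M P ν (fun k => φ (s k)) H N U ε j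
    (currentWord ((scalableMax K M m φ P ν).transcript s H N U ω j))}

theorem accurateUpTo_succ (ε : ℝ) (J : ℕ) :
    accurateUpTo M m φ P ν s H N U ε (J + 1) =
      {ω | ω ∈ accurateUpTo M m φ P ν s H N U ε J ∧
        ω ∈ accurate M P ν (fun k => φ (s k)) H N U ε J
          (currentWord ((scalableMax K M m φ P ν).transcript s H N U ω J))} := by
  ext ω
  exact Nat.forall_lt_succ_right

theorem measurableSet_accurateUpTo (ε : ℝ) (J : ℕ) :
    MeasurableSet[sourceAlgebra H N U {i | i.1 < 3 * M * J}]
      (accurateUpTo M m φ P ν s H N U ε J) := by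
  induction J with
  | zero =>
    have : accurateUpTo M m φ P ν s H N U ε 0 = Set.univ := by
      ext ω; simp [accurateUpTo]
    rw [this]
    exact @MeasurableSet.univ _ (sourceAlgebra H N U _)
  | succ J ih =>
    have hsub : {i : ℕ × Source K | i.1 < 3 * M * J} ⊆ {i | i.1 < 3 * M * (J + 1)} := by
      intro i hi
      have hi : i.1 < 3 * M * J := hi
      exact hi.trans_le (Nat.mul_le_mul_left _ (Nat.le_succ J))
    have e : accurateUpTo M m φ P ν s H N U ε (J + 1) =
        accurateUpTo M m φ P ν s H N U ε J ∩ ⋃ h,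
          {ω | (scalableMax K M m φ P ν).transcript s H N U ω J = h} ∩
            accurate M P ν (fun k => φ (s k)) H N U ε J (currentWord h) := by
      rw [accurateUpTo_succ]
      ext ω
      simp
    rw [e]
    refine (sourceAlgebra_mono H N U hsub _ ih).inter
      (MeasurableSet.iUnion fun h => MeasurableSet.inter ?_ ?_)
    · exact sourceAlgebra_mono H N U hsub _ (measurableSet_transcript_eq M m φ P ν s H N U J h)
    · exact measurableSet_accurate M P ν _ H N U (fun q i c => useIndex_lt M J q i) ε _

end Transcript

/-- The past (transcript and earlier accuracy) depends on uses before `3 * M * J`, the accuracy of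
step `J` about any fixed word on later ones. After the scheme has ended the word is frozen, but the
estimates remain defined, so every step contributes the same factor. -/
theorem IsFadingChannel.le_measure_accurateUpTo {Ω α : Type*} [MeasurableSpace Ω] {μ : Measure Ω}
    [IsProbabilityMeasure μ] {K : ℕ} {H : ℕ → Fin K → Ω → ℂ} {N : ℕ → Ω → ℂ}
    {U : ℕ → Fin K → Ω → ℝ} {σF σN : ℝ} (hc : IsFadingChannel μ H N U σF σN)
    (hσF : 0 < σF) (hσN : 0 ≤ σN) (hK : 0 < K) {P : ℝ} (hP : 0 < P) {M : ℕ} (hM : 0 < M)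
    {ε : ℝ} (hε : 0 < ε) (m : ℕ) (φ : α → Lex (ℕ → Bool)) (s : Fin K → α) (J : ℕ) :
    ENNReal.ofReal (1 - sumErrorBound M K σF σN P ε) ^ (3 * J) ≤
      μ (accurateUpTo M m φ P (fun t => ∫ ω, ‖N t ω‖ ^ 2 ∂μ) s H N U ε J) := by
  set ν : ℕ → ℝ := fun t => ∫ ω, ‖N t ω‖ ^ 2 ∂μ with hν
  induction J with
  | zero =>
    have : accurateUpTo M m φ P ν s H N U ε 0 = Set.univ := by
      ext ω; simp [accurateUpTo]
    simp [this]
  | succ J ih =>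
    rw [mul_add, mul_one, pow_add, mul_comm, accurateUpTo_succ]
    refine le_trans (mul_le_mul_right ih _) ?_
    have hd : Disjoint {i : ℕ × Source K | i.1 < 3 * M * J}
        {i : ℕ × Source K | 3 * M * J ≤ i.1} := by
      rw [Set.disjoint_left]
      intro i h1 h2
      exact (not_lt.2 (show 3 * M * J ≤ i.1 from h2)) h1
    exact mul_measure_le_measure_adaptive (hc.sourceAlgebra_le _) (hc.sourceAlgebra_le _)
      (hc.indep_sourceAlgebra hd)
      (f := fun ω => (scalableMax K M m φ P ν).transcript s H N U ω J)
      (G := fun h => accurate M P ν (fun k => φ (s k)) H N U ε J (currentWord h))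
      (fun h => (measurableSet_accurateUpTo M m φ P ν s H N U ε J).inter
        (measurableSet_transcript_eq M m φ P ν s H N U J h))
      (fun h => measurableSet_accurate M P ν _ H N U (fun q i c => le_useIndex M J q i) ε _)
      (fun h => hc.le_measure_accurate hσF hσN hK hP hM hε _ J _)

/-! ### Prefixes of binary sequences -/

theorem length_bitPrefix (b : Lex (ℕ → Bool)) (n : ℕ) : (bitPrefix b n).length = n := by
  simp [bitPrefix]

theorem bitPrefix_succ (b : Lex (ℕ → Bool)) (n : ℕ) :
    bitPrefix b (n + 1) = bitPrefix b n ++ [ofLex b n] := by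
  simp [bitPrefix, List.range_succ]

theorem append_singleton_lt_iff {x y : List Bool} (h : x.length = y.length) (c c' : Bool) :
    x ++ [c] < y ++ [c'] ↔ x < y ∨ x = y ∧ c < c' := by
  induction x generalizing y with
  | nil =>
    obtain rfl : y = [] := List.length_eq_zero_iff.1 h.symm
    simp [List.cons_lt_cons_iff]
  | cons a x ih =>
    rcases y with _ | ⟨a', y⟩
    · simp at h
    · simp only [List.length_cons, Nat.add_right_cancel_iff] at h
      simp only [List.cons_append, List.cons_lt_cons_iff, ih h, List.cons.injEq]
      tauto

/-- The first differing bit `i` decides: prefixes of length at most `i` agree, longer ones are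
strictly ordered. -/
theorem bitPrefix_eq_or_lt {b b' : Lex (ℕ → Bool)} (h : b ≤ b') (n : ℕ) :
    bitPrefix b n = bitPrefix b' n ∨ bitPrefix b n < bitPrefix b' n := by
  rcases h.eq_or_lt with rfl | ⟨i, hi, hlt⟩
  · exact Or.inl rfl
  · have key : (n ≤ i → bitPrefix b n = bitPrefix b' n) ∧
        (i < n → bitPrefix b n < bitPrefix b' n) := by
      induction n with
      | zero => simp [bitPrefix]
      | succ n ih =>
        have hl : (bitPrefix b n).length = (bitPrefix b' n).length := by
          rw [length_bitPrefix, length_bitPrefix]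
        rw [bitPrefix_succ, bitPrefix_succ, append_singleton_lt_iff hl]
        constructor
        · intro hn
          have hbit : ofLex b n = ofLex b' n := hi n hn
          rw [ih.1 (by omega), hbit]
        · intro hn
          rcases (Nat.lt_succ_iff.1 hn).eq_or_lt with rfl | h'
          · exact Or.inr ⟨ih.1 le_rfl, hlt⟩
          · exact Or.inl (ih.2 h')
    rcases le_or_gt n i with hn | hn
    · exact Or.inl (key.1 hn)
    · exact Or.inr (key.2 hn)

theorem IsAbove.mono {x : List Bool} {b b' : Lex (ℕ → Bool)} (h : b ≤ b') (hx : IsAbove x b) :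
    IsAbove x b' := by
  rcases bitPrefix_eq_or_lt h x.length with h1 | h1
  · unfold IsAbove; rw [← h1]; exact hx
  · exact lt_trans hx h1

theorem HasPrefix.isAbove_or {x : List Bool} {b b' : Lex (ℕ → Bool)} (h : b ≤ b')
    (hx : HasPrefix x b) : IsAbove x b' ∨ HasPrefix x b' := by
  have hx : bitPrefix b x.length = x := hx
  rcases bitPrefix_eq_or_lt h x.length with h1 | h1
  · exact Or.inr (h1.symm.trans hx)
  · rw [hx] at h1
    exact Or.inl h1

theorem hasPrefix_append_iff {x : List Bool} {c : Bool} {b : Lex (ℕ → Bool)} :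
    HasPrefix (x ++ [c]) b ↔ HasPrefix x b ∧ ofLex b x.length = c := by
  unfold HasPrefix
  rw [List.length_append, List.length_singleton, bitPrefix_succ]
  constructor
  · intro h
    simpa using List.append_inj h (length_bitPrefix _ _)
  · rintro ⟨h, h'⟩
    rw [h, h']

theorem isAbove_append_iff {x : List Bool} {c : Bool} {b : Lex (ℕ → Bool)} :
    IsAbove (x ++ [c]) b ↔ IsAbove x b ∨ (HasPrefix x b ∧ c < ofLex b x.length) := by
  unfold IsAbove HasPrefix
  rw [List.length_append, List.length_singleton, bitPrefix_succ,
    append_singleton_lt_iff (length_bitPrefix _ _).symm, eq_comm (a := x)]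

theorem isAbove_append_true_iff {x : List Bool} {b : Lex (ℕ → Bool)} :
    IsAbove (x ++ [true]) b ↔ IsAbove x b := by
  rw [isAbove_append_iff]
  constructor
  · rintro (h | ⟨-, h⟩)
    · exact h
    · exact absurd h (by cases ofLex b x.length <;> decide)
  · exact Or.inl

theorem isAbove_append_false_iff {x : List Bool} {b : Lex (ℕ → Bool)} :
    IsAbove (x ++ [false]) b ↔ IsAbove x b ∨ HasPrefix (x ++ [true]) b := by
  rw [isAbove_append_iff, hasPrefix_append_iff]
  cases ofLex b x.length <;> simp

theorem isAbove_nil (b : Lex (ℕ → Bool)) : ¬ IsAbove [] b := by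
  simp [IsAbove, bitPrefix]

theorem hasPrefix_nil (b : Lex (ℕ → Bool)) : HasPrefix [] b := by
  simp [HasPrefix, bitPrefix]

theorem bitPrefix_eq_of_le {b b' : Lex (ℕ → Bool)} {n n' : ℕ} (hn : n ≤ n')
    (h : bitPrefix b n' = bitPrefix b' n') : bitPrefix b n = bitPrefix b' n := by
  simp only [bitPrefix, List.map_inj_left, List.mem_range] at h ⊢
  exact fun i hi => h i (hi.trans_le hn)

section DescriptionLength

variable {K : ℕ} {b : Fin K → Lex (ℕ → Bool)}

theorem bitPrefix_descriptionLength_ne (hb : Function.Injective b) {j k : Fin K} (hjk : j ≠ k) :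
    bitPrefix (b j) (descriptionLength b k) ≠ bitPrefix (b k) (descriptionLength b k) := by
  have hex : ∀ j, j ≠ k → ∃ n, bitPrefix (b j) n ≠ bitPrefix (b k) n := by
    intro j hj
    by_contra! hcon
    refine hj (hb (ofLex_inj.1 (funext fun i => ?_)))
    have := hcon (i + 1)
    simp only [bitPrefix, List.map_inj_left, List.mem_range] at this
    exact this i (Nat.lt_succ_self i)
  choose! f hf using hex
  -- Distinct prefixes stay distinct when lengthened, so the largest of the finitely many separating
  -- lengths works for all agents.
  have hne : {n | ∀ j, j ≠ k → bitPrefix (b j) n ≠ bitPrefix (b k) n}.Nonempty :=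
    ⟨Finset.univ.sup f, fun j hj h =>
      hf j hj (bitPrefix_eq_of_le (Finset.le_sup (Finset.mem_univ j)) h)⟩
  exact Nat.sInf_mem hne j hjk

/-- Two agents sharing `x` are not yet separated, whereas prefixes of length `d` or more separate
all agents. This limits the number of appended bits. -/
theorem length_lt_maxDescriptionLength (hb : Function.Injective b) {x : List Bool}
    (h : 1 < {k | HasPrefix x (b k)}.ncard) : x.length < maxDescriptionLength b := by
  obtain ⟨j, k, hj, hk, hjk⟩ := (Set.one_lt_ncard_iff (Set.toFinite _)).1 h
  by_contra! hle
  refine bitPrefix_descriptionLength_ne hb hjk (bitPrefix_eq_of_le ?_ (hj.trans hk.symm))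
  exact (Finset.le_sup (Finset.mem_univ k)).trans hle

end DescriptionLength

/-! ### One step of ScalableMax with accurate estimates -/

section Step

variable {K : ℕ} (b : Fin K → Lex (ℕ → Bool))

theorem sum_queryIndicator (x : List Bool) (q : Fin 3) :
    ∑ k, queryIndicator b x q k = ({k | Query x (b k) q}.ncard : ℝ) := by
  classical
  simp only [queryIndicator]
  rw [Finset.sum_boole, Set.ncard_eq_toFinset_card']
  congr 2
  ext k
  simp

/-- The property of the current word that is kept in all steps with accurate estimates. -/
def Admissible (m : ℕ) (x : List Bool) : Prop :=
  (∃ k, IsAbove x (b k) ∨ HasPrefix x (b k)) ∧ {k | IsAbove x (b k)}.ncard ≤ m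

variable {b}

theorem admissible_nil (hK : 0 < K) (m : ℕ) : Admissible b m [] := by
  refine ⟨⟨⟨0, hK⟩, Or.inr (hasPrefix_nil _)⟩, ?_⟩
  simp [isAbove_nil]

variable {m : ℕ} {x : List Bool} {e : Fin 3 → ℝ}

/-- If `e 0 ≥ m / 4`, the true count above `x` is positive, and the invariant bounds it by `m`.
Otherwise fewer than `m / 2` agents are above `x` and fewer than `m / 2 + 1` have prefix `x`. -/
theorem react_eq_finish (hm : Even m) (hx : Admissible b m x)
    (he : ∀ q, |e q - ({k | Query x (b k) q}.ncard : ℝ)| < (m : ℝ) / 4) {w : Bool}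
    (hr : react m e = .finish w) :
    (∃ k, IsAbove x (b k) ∨ (w = true ∧ HasPrefix x (b k))) ∧
      {k | IsAbove x (b k) ∨ (w = true ∧ HasPrefix x (b k))}.ncard ≤ m := by
  have h0 : |e 0 - ({k | IsAbove x (b k)}.ncard : ℝ)| < (m : ℝ) / 4 := he 0
  have h1 : |e 1 - ({k | HasPrefix x (b k)}.ncard : ℝ)| < (m : ℝ) / 4 := he 1
  rw [abs_lt] at h0 h1
  unfold react at hr
  split_ifs at hr with c0 c1 c2
  · obtain rfl : false = w := by simpa using hr
    have hpos : 0 < {k | IsAbove x (b k)}.ncard := by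
      have : (0 : ℝ) < {k | IsAbove x (b k)}.ncard := by linarith
      exact_mod_cast this
    obtain ⟨k, hk⟩ := (Set.ncard_pos (Set.toFinite _)).1 hpos
    exact ⟨⟨k, Or.inl hk⟩, by simpa using hx.2⟩
  · obtain rfl : true = w := by simpa using hr
    obtain ⟨l, rfl⟩ := hm
    push_cast at *
    have k0 : {k | IsAbove x (b k)}.ncard < l := by
      have : ({k | IsAbove x (b k)}.ncard : ℝ) < l := by linarith
      exact_mod_cast this
    have k1 : {k | HasPrefix x (b k)}.ncard < l + 1 := by
      have : ({k | HasPrefix x (b k)}.ncard : ℝ) < l + 1 := by linarith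
      exact_mod_cast this
    refine ⟨by simpa using hx.1, ?_⟩
    have hu : {k | IsAbove x (b k) ∨ (true = true ∧ HasPrefix x (b k))} =
        {k | IsAbove x (b k)} ∪ {k | HasPrefix x (b k)} := by
      ext k; simp
    rw [hu]
    have := Set.ncard_union_le {k | IsAbove x (b k)} {k | HasPrefix x (b k)}
    omega

/-- Reaching this branch requires `e 1 ≥ m / 4 + 1`, hence a true count above 1. Bit `1` leaves the
agents above unchanged and is chosen only if someone has prefix `x1`. Bit `0` loses nobody, and adds
to the agents above those with prefix `x1`; each of these two groups has fewer than `m / 2` members.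
-/
theorem react_eq_append (hx : Admissible b m x)
    (he : ∀ q, |e q - ({k | Query x (b k) q}.ncard : ℝ)| < (m : ℝ) / 4) {c : Bool}
    (hr : react m e = .append c) :
    Admissible b m (x ++ [c]) ∧ 1 < {k | HasPrefix x (b k)}.ncard := by
  have h0 : |e 0 - ({k | IsAbove x (b k)}.ncard : ℝ)| < (m : ℝ) / 4 := he 0
  have h1 : |e 1 - ({k | HasPrefix x (b k)}.ncard : ℝ)| < (m : ℝ) / 4 := he 1
  have h2 : |e 2 - ({k | HasPrefix (x ++ [true]) (b k)}.ncard : ℝ)| < (m : ℝ) / 4 := he 2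
  rw [abs_lt] at h0 h1 h2
  unfold react at hr
  split_ifs at hr with c0 c1 c2
  all_goals
    have hone : 1 < {k | HasPrefix x (b k)}.ncard := by
      have : (1 : ℝ) < {k | HasPrefix x (b k)}.ncard := by linarith
      exact_mod_cast this
    refine ⟨?_, hone⟩
  · obtain rfl : true = c := by simpa using hr
    have hpos : 0 < {k | HasPrefix (x ++ [true]) (b k)}.ncard := by
      have : (0 : ℝ) < {k | HasPrefix (x ++ [true]) (b k)}.ncard := by linarith
      exact_mod_cast this
    obtain ⟨k, hk⟩ := (Set.ncard_pos (Set.toFinite _)).1 hpos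
    refine ⟨⟨k, Or.inr hk⟩, ?_⟩
    simpa only [isAbove_append_true_iff] using hx.2
  · obtain rfl : false = c := by simpa using hr
    constructor
    · obtain ⟨k, hk⟩ := hx.1
      refine ⟨k, ?_⟩
      rw [isAbove_append_iff, hasPrefix_append_iff]
      cases ofLex (b k) x.length <;> simp [hk]
    · have hu : {k | IsAbove (x ++ [false]) (b k)} =
          {k | IsAbove x (b k)} ∪ {k | HasPrefix (x ++ [true]) (b k)} := by
        ext k
        simp [isAbove_append_false_iff]
      rw [hu]
      refine (Set.ncard_union_le _ _).trans ?_
      have : ({k | IsAbove x (b k)}.ncard : ℝ) + {k | HasPrefix (x ++ [true]) (b k)}.ncard ≤ m := by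
        linarith
      exact_mod_cast this

end Step

theorem weakMaxConsensus_of_remaining {K m : ℕ} {α : Type*} [LinearOrder α]
    {φ : α → Lex (ℕ → Bool)} (hφ : Monotone φ) {s : Fin K → α} {x : List Bool} {w : Bool}
    {out : Fin K → Bool}
    (hout : ∀ k, out k = true ↔ IsAbove x (φ (s k)) ∨ (w = true ∧ HasPrefix x (φ (s k))))
    (hne : ∃ k, IsAbove x (φ (s k)) ∨ (w = true ∧ HasPrefix x (φ (s k))))
    (hcard : {k | IsAbove x (φ (s k)) ∨ (w = true ∧ HasPrefix x (φ (s k)))}.ncard ≤ m) :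
    WeakMaxConsensus m s out := by
  refine ⟨?_, ?_, fun i j hi hj => ?_⟩
  · simpa only [hout] using hne
  · simpa only [hout] using hcard
  · by_contra! hle
    -- The remaining set is closed upwards, so an excluded agent cannot hold an input at least as
    -- large as that of a remaining one.
    have hb := hφ hle
    refine absurd ((hout j).2 ?_) (by simp [hj])
    rcases (hout i).1 hi with h | ⟨hw, h⟩
    · exact Or.inl (h.mono hb)
    · exact (h.isAbove_or hb).imp_right fun h' => ⟨hw, h'⟩

/-! ### Correctness of ScalableMax -/

theorem currentWord_concat_append (h : List Message) (c : Bool) :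
    currentWord (h ++ [.append c]) = currentWord h ++ [c] := by
  simp [currentWord]

theorem currentWord_concat_finish (h : List Message) (w : Bool) :
    currentWord (h ++ [.finish w]) = currentWord h := by
  simp [currentWord]

section Correctness

variable {Ω α : Type*} [LinearOrder α] {K M m : ℕ} {φ : α → Lex (ℕ → Bool)} {P : ℝ} {ν : ℕ → ℝ}
  {s : Fin K → α} {H : ℕ → Fin K → Ω → ℂ} {N : ℕ → Ω → ℂ} {U : ℕ → Fin K → Ω → ℝ} {ω : Ω}

/-- A run with accurate estimates is either finished correctly or still running with the invariant.
In the latter case the transcript has length `j`, so the next step really uses the estimates of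
block `j`, and the word has length `j`, which ties the step count to `d`. -/
theorem transcript_of_accurateUpTo (hK : 0 < K) (hφ : StrictMono φ) (hs : Function.Injective s)
    (hm : Even m) {J : ℕ} (hω : ω ∈ accurateUpTo M m φ P ν s H N U ((m : ℝ) / 4) J) {j : ℕ}
    (hj : j ≤ J) :
    ((scalableMax K M m φ P ν).halted ((scalableMax K M m φ P ν).transcript s H N U ω j) = true ∧
      WeakMaxConsensus m s fun k => (scalableMax K M m φ P ν).decision k (s k)
        ((scalableMax K M m φ P ν).transcript s H N U ω j)) ∨
    ((scalableMax K M m φ P ν).halted ((scalableMax K M m φ P ν).transcript s H N U ω j) = false ∧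
      ((scalableMax K M m φ P ν).transcript s H N U ω j).length = j ∧
      (currentWord ((scalableMax K M m φ P ν).transcript s H N U ω j)).length = j ∧
      Admissible (fun k => φ (s k)) m
        (currentWord ((scalableMax K M m φ P ν).transcript s H N U ω j)) ∧
      j ≤ maxDescriptionLength fun k => φ (s k)) := by
  induction j with
  | zero =>
    right
    simp only [StarProtocol.transcript]
    exact ⟨rfl, rfl, rfl, admissible_nil hK m, Nat.zero_le _⟩
  | succ j ih =>
    have hacc := hω j hj
    have ih := ih (by omega)
    rw [transcript_succ]
    set h := (scalableMax K M m φ P ν).transcript s H N U ω j with hh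
    rcases ih with ⟨h1, h2⟩ | ⟨h1, h2, h3, h4, h5⟩
    · left
      rw [nextTranscript, if_pos h1]
      exact ⟨h1, h2⟩
    · rw [nextTranscript, if_neg (by simp [h1]), h2]
      simp only [accurate, Set.mem_ofPred_eq, sum_queryIndicator] at hacc
      rcases hr : react m fun q =>
          estimate M P ν (fun k => φ (s k)) H N U j (currentWord h) q ω with c | w
      · right
        obtain ⟨g1, g2⟩ := react_eq_append h4 hacc hr
        have g3 := length_lt_maxDescriptionLength (hφ.injective.comp hs) g2
        rw [currentWord_concat_append]
        refine ⟨?_, by simp [h2], by simp [h3], g1, ?_⟩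
        · simp [scalableMax]
        · rw [h3] at g3
          exact g3
      · left
        obtain ⟨g1, g2⟩ := react_eq_finish hm h4 hacc hr
        refine ⟨by simp [scalableMax], weakMaxConsensus_of_remaining hφ.monotone ?_ g1 g2⟩
        intro k
        simp [scalableMax, currentWord_concat_finish]

theorem reaches_of_accurateUpTo (hK : 0 < K) (hM : 0 < M) (hφ : StrictMono φ)
    (hs : Function.Injective s) (hm : Even m)
    (hω : ω ∈ accurateUpTo M m φ P ν s H N U ((m : ℝ) / 4)
      (maxDescriptionLength (fun k => φ (s k)) + 1)) :
    (scalableMax K M m φ P ν).Reaches m s H N U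
      (3 * M * (maxDescriptionLength (fun k => φ (s k)) + 1))
      (M * (maxDescriptionLength (fun k => φ (s k)) + 1)) ω := by
  rcases transcript_of_accurateUpTo hK hφ hs hm hω le_rfl with ⟨h1, h2⟩ | ⟨-, -, -, -, h⟩
  · have hl := length_transcript_le M m φ P ν s H N U ω
      (maxDescriptionLength (fun k => φ (s k)) + 1)
    exact ⟨_, h1, Nat.mul_le_mul_left _ hl, hl.trans (Nat.le_mul_of_pos_left _ hM), h2⟩
  -- A scheme still running after `d + 1` steps would give `d + 1 ≤ d`.
  · omega

end Correctness

theorem IsFadingChannel.peakPowerConstraint {Ω α : Type*} [MeasurableSpace Ω] {μ : Measure Ω}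
    [IsProbabilityMeasure μ] {K : ℕ} {H : ℕ → Fin K → Ω → ℂ} {N : ℕ → Ω → ℂ}
    {U : ℕ → Fin K → Ω → ℝ} {σF σN : ℝ} (hc : IsFadingChannel μ H N U σF σN) {P : ℝ}
    (hP : 0 < P) (M m : ℕ) (φ : α → Lex (ℕ → Bool)) (ν : ℕ → ℝ) (s : Fin K → α) :
    (scalableMax K M m φ P ν).PeakPowerConstraint μ s H N U P := by
  have hall : ∀ᵐ ω ∂μ, ∀ t k, U t k ω = 1 ∨ U t k ω = -1 :=
    ae_all_iff.2 fun t => ae_all_iff.2 fun k => hc.ae_sign t k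
  filter_upwards [hall] with ω hω t i k
  have key : ∀ (a u : ℝ), 0 ≤ a → a ≤ 1 → u ^ 2 = 1 → ‖sumEncode P a u‖ ^ 2 ≤ P := by
    intro a u ha0 ha1 hu
    rw [sumEncode, Complex.norm_real, Real.norm_eq_abs, sq_abs, mul_pow, hu, mul_one,
      Real.sq_sqrt (by positivity)]
    nlinarith
  refine key _ _ ?_ ?_ ?_
  · split_ifs <;> norm_num
  · split_ifs <;> norm_num
  · rcases hω ((scalableMax K M m φ P ν).uses *
      ((scalableMax K M m φ P ν).transcript s H N U ω t).length + i) k with h | h <;>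
    simp [h]

end MaxConsensus

open MaxConsensus

theorem mainTheorem4 {Ω : Type*} [MeasurableSpace Ω] (μ : Measure Ω) [IsProbabilityMeasure μ]
    {K : ℕ} (hK : 0 < K) {σF σN P : ℝ} (hσF : 0 ≤ σF) (hσN : 0 ≤ σN) (hP : 0 < P)
    (H : ℕ → Fin K → Ω → ℂ) (N : ℕ → Ω → ℂ) (U : ℕ → Fin K → Ω → ℝ)
    (hchannel : IsFadingChannel μ H N U σF σN)
    {α : Type*} [LinearOrder α] (φ : α → Lex (ℕ → Bool)) (hφ : StrictMono φ)
    (M m : ℕ) (hM : 0 < M) (hm : 0 < m) (hm_even : Even m)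
    (γ : ℝ) (hγ : γ = sumErrorBound M K σF σN P ((m : ℝ) / 4)) (hγ_le : γ ≤ 1)
    (p : StarProtocol K α Message)
    (hp : p = scalableMax K M m φ P (fun t => ∫ ω, ‖N t ω‖ ^ 2 ∂μ))
    (s : Fin K → α) (hs : Function.Injective s)
    (d : ℕ) (hd : d = maxDescriptionLength (fun k => φ (s k))) :
    p.PeakPowerConstraint μ s H N U P ∧
    (1 - γ) ^ (3 * (d + 1)) ≤
      μ.real {ω | p.Reaches m s H N U (3 * M * (d + 1)) (M * (d + 1)) ω} := by
  subst hp
  refine ⟨hchannel.peakPowerConstraint hP M m φ _ s, ?_⟩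
  have hε : (0 : ℝ) < (m : ℝ) / 4 := by positivity
  -- With `σF = 0` the fading would vanish almost surely, contradicting its variance 1.
  have hσF' : 0 < σF := by
    refine hσF.lt_of_ne fun h => ?_
    have hvar := hchannel.fading_var_re 0 ⟨0, hK⟩
    have hsub := hasSubgaussianMGF_of_subGaussianNorm_le hσF
      (hchannel.fading_mean_re 0 ⟨0, hK⟩) (hchannel.fading_norm_re 0 ⟨0, hK⟩)
    rw [← h, Real.toNNReal_zero, zero_pow two_ne_zero] at hsub
    rw [variance_congr hsub.ae_eq_zero_of_hasSubgaussianMGF_zero, variance_zero] at hvar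
    exact zero_ne_one hvar
  have hprob := hchannel.le_measure_accurateUpTo hσF' hσN hK hP hM hε m φ s (d + 1)
  rw [← hγ, ← ENNReal.ofReal_pow (sub_nonneg.2 hγ_le),
    ENNReal.ofReal_le_iff_le_toReal (measure_ne_top _ _)] at hprob
  refine hprob.trans (measureReal_mono fun ω hω => ?_)
  subst hd
  exact reaches_of_accurateUpTo hK hM hφ hs hm_even hω
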